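/- Let $n>3$. The Hopf map $\mathbb{H}\to\mathbb{R}^3$ is $\operatorname{Hopf}(q)=\bar q\,\mathbf{i}\,q$, where the imaginary quaternions are identified with $\mathbb{R}^3$. The Hopf-Gaussian measure on the space $\mathscr{A}_3(n)=(\mathbb{R}^3)^n$ of $n$-edge arms $(\vec e_1,\dots,\vec e_n)$ is the pushforward of the standard Gaussian measure on $\mathbb{H}^n=\mathbb{R}^{4n}$ by the coordinatewise Hopf map. The Hopf-Gaussian measure on the space $\mathscr{P}_3(n)=\{\sum_i \vec e_i=\vec 0\}\subset\mathscr{A}_3(n)$ of closed polygons is the corresponding probability measure conditioned on closure, i.e. the weak limit, as $\varepsilon\to0^+$, of the Hopf-Gaussian measure on $\mathscr{A}_3(n)$ conditioned on $|\sum_i\vec e_i|<\varepsilon$; this limit exists and is unique. Let $\vec e_1,\vec e_2$ be two (cyclically) consecutive edges of a random closed polygon distributed according to the Hopf-Gaussian measure on $\mathscr{P}_3(n)$. Then the joint distribution of $(\vec e_1,\vec e_2)$ on $\mathbb{R}^3\times\mathbb{R}^3$ is invariant under the diagonal action of $SO(3)$ and under rotations which fix one of the two edges (also when the rotation depends measurably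 on the fixed edge). It has a density with respect to $\operatorname{dVol}_{\vec e_1}\operatorname{dVol}_{\vec e_2}$ which depends only on the lengths $r_1=|\vec e_1|$, $r_2=|\vec e_2|$ and the angle $\theta\in[0,\pi]$ between $\vec e_1$ and $\vec e_2$. The joint density of $(r_1,r_2,\theta)$ with respect to $\mathrm{d}r_1\,\mathrm{d}r_2\,\mathrm{d}\theta$ on $(0,\infty)\times(0,\infty)\times(0,\pi)$ is $$P(r_1,r_2,\theta)=\frac{\Gamma(n)}{4\sqrt{\pi}\,\Gamma(2n-4)}\,r_1r_2\,e^{-\frac12(r_1+r_2)}\,z^{n-\frac72}\,K_{n-\frac72}\!\left(\frac z2\right)\sin\theta,$$ where $z=|\vec e_1+\vec e_2|=\sqrt{r_1^2+r_2^2+2r_1r_2\cos\theta}$ and $K_\nu(u)=\int_0^\infty e^{-u\cosh t}\cosh(\nu t)\,\mathrm{d}t$ $(u>0)$ is the modified Bessel function of the second kind. Moreover, the joint density of $x=(r_1+r_2)/2$, $y=(r_1-r_2)/2$ and $z=|\vec e_1+\vec e_2|$ with respect to $\mathrm{d}x\,\mathrm{d}y\,\mathrm{d}z$ on the region $\{z>0,\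 x>z/2,\ |y|<z/2\}$ (and zero outside it) is $$P(x,y,z)=\frac{\Gamma(n)}{2\sqrt{\pi}\,\Gamma(2n-4)}\,e^{-x}\,z^{n-\frac52}\,K_{n-\frac72}\!\left(\frac z2\right).$$ -/

import Mathlib

open MeasureTheory ProbabilityTheory Filter Topology Set
open scoped ENNReal Quaternion BoundedContinuousFunction

noncomputable section

namespace HopfPolygon

/-- Euclidean 3-space. -/
abbrev E3 : Type := EuclideanSpace ℝ (Fin 3)

/-- The space of `n`-edge arms in `ℝ³` up to translation: lists of `n` edge vectors. -/
abbrev Arm (n : ℕ) : Type := Fin n → E3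

/-- The space of closed `n`-gons in `ℝ³` up to translation: arms whose edges sum to zero. -/
def closedPolygons (n : ℕ) : Set (Arm n) := {e | ∑ i, e i = 0}

/-- The quaternion with coordinates `q 0 + q 1 𝐢 + q 2 𝐣 + q 3 𝐤`. -/
def quat (q : Fin 4 → ℝ) : ℍ[ℝ] := (Quaternion.equivTuple ℝ).symm q

/-- The Hopf map `q ↦ q̄ 𝐢 q`, with imaginary quaternions identified with `ℝ³`. -/
def hopf (q : ℍ[ℝ]) : E3 :=
  let w : ℍ[ℝ] := star q * quat ![0, 1, 0, 0] * q
  !₂[w.imI, w.imJ, w.imK]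

/-- The standard Gaussian measure on `ℍⁿ = ℝ⁴ⁿ`, in coordinates: all `4n` real coordinates are
independent standard normals. -/
def gaussianHn (n : ℕ) : Measure (Fin n → Fin 4 → ℝ) :=
  Measure.pi fun _ => Measure.pi fun _ => gaussianReal 0 1

/-- The Hopf-Gaussian measure on arm space: the pushforward of the standard Gaussian measure on
`ℍⁿ` by the coordinatewise Hopf map. -/
def hopfGaussianArm (n : ℕ) : Measure (Arm n) :=
  (gaussianHn n).map fun q i => hopf (quat (q i))

/-- `μ` is the Hopf-Gaussian probability measure on closed `n`-gons, that is, the subspace measure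
inherited from arm space: the law of a Hopf-Gaussian arm conditioned on closure. As closure is a
null event, this is the weak limit, as `ε → 0⁺`, of the Hopf-Gaussian measure conditioned on the
tube `‖e₁ + ⋯ + eₙ‖ < ε` around the linear subspace of closed polygons (up to the factor `√n` in
`ε`, these tubes are the metric neighbourhoods of the subspace in `ℝ³ⁿ`). -/
def IsHopfGaussianPolygonMeasure (n : ℕ) (μ : Measure (closedPolygons n)) : Prop :=
  IsProbabilityMeasure μ ∧
    ∀ f : Arm n →ᵇ ℝ,
      Tendsto (fun ε : ℝ => ∫ e, f e ∂(cond (hopfGaussianArm n) {e : Arm n | ‖∑ i, e i‖ < ε}))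
        (𝓝[>] 0) (𝓝 (∫ p : closedPolygons n, f p ∂μ))

/-- The joint law of the consecutive edges `eᵢ, eᵢ₊₁` (indices cyclic) of a closed polygon with
law `μ`. -/
def edgePairLaw {n : ℕ} (μ : Measure (closedPolygons n)) (i : Fin n) : Measure (E3 × E3) :=
  μ.map fun p => (p.1 i, p.1 (finRotate n i))

/-- The rotation group of `ℝ³`. -/
abbrev SO3 : Type := Matrix.specialOrthogonalGroup (Fin 3) ℝ

/-- The action of rotations on `ℝ³`. -/
def rot (A : SO3) (v : E3) : E3 := WithLp.toLp 2 (A.1.mulVec v.ofLp)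

/-- The modified Bessel function of the second kind `K_ν(z)`, for `z > 0`. -/
def besselK (ν z : ℝ) : ℝ := ∫ t in Ioi (0 : ℝ), Real.exp (-z * Real.cosh t) * Real.cosh (ν * t)

/-- The length of the sum of two vectors of lengths `r₁, r₂` at angle `θ`. -/
def chord (r₁ r₂ θ : ℝ) : ℝ := Real.sqrt (r₁ ^ 2 + r₂ ^ 2 + 2 * r₁ * r₂ * Real.cos θ)

/-- The density `P(r₁, r₂, θ)`. -/
def pairDensity (n : ℕ) (r₁ r₂ θ : ℝ) : ℝ :=
  Real.Gamma n / (4 * Real.sqrt Real.pi * Real.Gamma (2 * (n : ℝ) - 4)) * (r₁ * r₂)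
    * Real.exp (-(1 / 2) * (r₁ + r₂)) * chord r₁ r₂ θ ^ ((n : ℝ) - 7 / 2)
    * besselK ((n : ℝ) - 7 / 2) (chord r₁ r₂ θ / 2) * Real.sin θ

/-- The density `P(x, y, z)`. -/
def pairDensityXYZ (n : ℕ) (x _y z : ℝ) : ℝ :=
  Real.Gamma n / (2 * Real.sqrt Real.pi * Real.Gamma (2 * (n : ℝ) - 4))
    * Real.exp (-x) * z ^ ((n : ℝ) - 5 / 2) * besselK ((n : ℝ) - 7 / 2) (z / 2)

end HopfPolygon

end

noncomputable section

namespace HopfPolygon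

theorem integrableOn_rpow_mul_exp_neg_add_div {ν c : ℝ} (hν : -1 < ν) (hc : 0 < c) :
    IntegrableOn (fun s : ℝ => s ^ (ν - 1) * Real.exp (-(s + c / s))) (Ioi 0) := by
  have hG : IntegrableOn (fun s : ℝ => c⁻¹ * (Real.exp (-s) * s ^ (ν + 1 - 1))) (Ioi 0) :=
    (Real.GammaIntegral_convergent (by linarith)).const_mul _
  refine Integrable.mono' hG (by fun_prop) ?_
  filter_upwards [ae_restrict_mem measurableSet_Ioi] with s hs
  have hs : 0 < s := hs
  have h1 : Real.exp (-(c / s)) ≤ s / c := by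
    rw [Real.exp_neg, inv_le_comm₀ (Real.exp_pos _) (by positivity), inv_div]
    linarith [Real.add_one_le_exp (c / s)]
  rw [Real.norm_of_nonneg (by positivity), neg_add, Real.exp_add]
  calc s ^ (ν - 1) * (Real.exp (-s) * Real.exp (-(c / s)))
      ≤ s ^ (ν - 1) * (Real.exp (-s) * (s / c)) := by gcongr
    _ = c⁻¹ * (Real.exp (-s) * (s ^ (ν - 1) * s)) := by ring
    _ = c⁻¹ * (Real.exp (-s) * s ^ (ν + 1 - 1)) := by
        rw [← Real.rpow_add_one hs.ne']; ring_nf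

theorem image_mul_exp_univ {a : ℝ} (ha : 0 < a) :
    (fun t : ℝ => a * Real.exp t) '' univ = Ioi 0 := by
  ext s
  simp only [image_univ, Set.mem_range, mem_Ioi]
  constructor
  · rintro ⟨t, rfl⟩; positivity
  · intro hs
    exact ⟨Real.log (s / a), by rw [Real.exp_log (by positivity)]; field_simp⟩

theorem integral_rpow_mul_exp_neg_add_div {ν u : ℝ} (hν : -1 < ν) (hu : 0 < u) :
    ∫ s in Ioi (0 : ℝ), s ^ (ν - 1) * Real.exp (-(s + (u / 2) ^ 2 / s)) =
      2 * (u / 2) ^ ν * besselK ν u := by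
  set a : ℝ := u / 2 with ha
  have ha0 : 0 < a := by positivity
  have hder : ∀ t ∈ (univ : Set ℝ),
      HasDerivWithinAt (fun t : ℝ => a * Real.exp t) (a * Real.exp t) univ t :=
    fun t _ => ((Real.hasDerivAt_exp t).const_mul a).hasDerivWithinAt
  have hinj : InjOn (fun t : ℝ => a * Real.exp t) univ := fun x _ y _ h =>
    Real.exp_injective (mul_left_cancel₀ ha0.ne' h)
  have hpt : ∀ t : ℝ, |a * Real.exp t| • ((a * Real.exp t) ^ (ν - 1) *
      Real.exp (-(a * Real.exp t + a ^ 2 / (a * Real.exp t)))) =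
      a ^ ν * (Real.exp (ν * t) * Real.exp (-u * Real.cosh t)) := by
    intro t
    have hp : 0 < a * Real.exp t := by positivity
    have h1 : a * Real.exp t * (a * Real.exp t) ^ (ν - 1) = a ^ ν * Real.exp (ν * t) := by
      rw [mul_comm, ← Real.rpow_add_one hp.ne', sub_add_cancel,
        Real.mul_rpow ha0.le (Real.exp_pos t).le, ← Real.exp_mul, mul_comm t]
    have h2 : -(a * Real.exp t + a ^ 2 / (a * Real.exp t)) = -u * Real.cosh t := by
      rw [Real.cosh_eq, Real.exp_neg, ha]
      have := Real.exp_pos t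
      field_simp
    rw [abs_of_pos hp, smul_eq_mul, ← mul_assoc, h1, h2, mul_assoc]
  have hintegrable := integrableOn_rpow_mul_exp_neg_add_div hν (c := a ^ 2) (by positivity)
  rw [← image_mul_exp_univ ha0, integrableOn_image_iff_integrableOn_abs_deriv_smul
    MeasurableSet.univ hder hinj, integrableOn_univ] at hintegrable
  rw [← image_mul_exp_univ ha0,
    integral_image_eq_integral_abs_deriv_smul MeasurableSet.univ hder hinj, setIntegral_univ]
  simp only [hpt] at hintegrable ⊢
  have hintegrable' : Integrable (fun t : ℝ => Real.exp (ν * t) * Real.exp (-u * Real.cosh t)) := by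
    have := hintegrable.const_mul (a ^ ν)⁻¹
    refine this.congr (Eventually.of_forall fun t => ?_)
    have : a ^ ν ≠ 0 := (Real.rpow_pos_of_pos ha0 ν).ne'
    simp [this]
  have hneg := integral_neg_eq_self
    (fun t : ℝ => Real.exp (ν * t) * Real.exp (-u * Real.cosh t)) volume
  have hsum := integral_add hintegrable' hintegrable'.comp_neg
  rw [hneg] at hsum
  have habs := integral_comp_abs (f := fun t : ℝ => Real.exp (-u * Real.cosh t) * Real.cosh (ν * t))
  have hcosh : ∀ t : ℝ, Real.exp (ν * t) * Real.exp (-u * Real.cosh t) +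
      Real.exp (ν * -t) * Real.exp (-u * Real.cosh (-t)) =
      2 * (Real.exp (-u * Real.cosh |t|) * Real.cosh (ν * |t|)) := by
    intro t
    have h : Real.cosh (ν * |t|) = Real.cosh (ν * t) := by
      rw [← Real.cosh_abs (ν * t), abs_mul, ← Real.cosh_abs (ν * |t|), abs_mul, abs_abs]
    rw [Real.cosh_abs, h, Real.cosh_neg, Real.cosh_eq (ν * t), mul_neg]
    ring
  simp only [hcosh] at hsum
  rw [integral_const_mul, habs] at hsum
  rw [integral_const_mul, besselK]
  linear_combination (a ^ ν / 2) * (-hsum)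

theorem image_sinh_half_Ioi : (fun t : ℝ => Real.sinh (t / 2)) '' Ioi 0 = Ioi 0 := by
  ext s
  simp only [Set.mem_image, mem_Ioi]
  constructor
  · rintro ⟨t, ht, rfl⟩
    exact Real.sinh_pos_iff.2 (by positivity)
  · intro hs
    exact ⟨2 * Real.arsinh s, by have := Real.arsinh_pos_iff.2 hs; positivity, by simp⟩

theorem besselK_neg_half (u : ℝ) :
    besselK (-1 / 2) u = Real.sqrt (Real.pi / (2 * u)) * Real.exp (-u) := by
  have hder : ∀ t ∈ Ioi (0 : ℝ), HasDerivWithinAt (fun t : ℝ => Real.sinh (t / 2))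
      (Real.cosh (t / 2) / 2) (Ioi 0) t := fun t _ => by
    have := ((hasDerivAt_id t).div_const 2).sinh
    simpa [div_eq_mul_inv] using this.hasDerivWithinAt
  have hinj : InjOn (fun t : ℝ => Real.sinh (t / 2)) (Ioi 0) := fun x _ y _ h => by
    have := Real.sinh_injective h
    linarith
  have h := integral_image_eq_integral_abs_deriv_smul measurableSet_Ioi hder hinj
    (fun w => Real.exp (-(2 * u) * w ^ 2))
  rw [image_sinh_half_Ioi, integral_gaussian_Ioi] at h
  have hpt : ∀ t : ℝ, Real.exp (-u * Real.cosh t) * Real.cosh (-1 / 2 * t) =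
      (2 * Real.exp (-u)) * (|Real.cosh (t / 2) / 2| • Real.exp (-(2 * u) * Real.sinh (t / 2) ^ 2)) := by
    intro t
    have h1 : Real.cosh t = 1 + 2 * Real.sinh (t / 2) ^ 2 := by
      conv_lhs => rw [show t = 2 * (t / 2) by ring, Real.cosh_two_mul, Real.cosh_sq]
      ring
    have h2 : Real.cosh (-1 / 2 * t) = Real.cosh (t / 2) := by
      rw [← Real.cosh_neg]; ring_nf
    rw [abs_of_pos (by have := Real.cosh_pos (t / 2); positivity), h1, h2,
      show -u * (1 + 2 * Real.sinh (t / 2) ^ 2) = -u + -(2 * u) * Real.sinh (t / 2) ^ 2 by ring,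
      Real.exp_add, smul_eq_mul]
    ring
  rw [besselK]
  simp only [hpt]
  rw [integral_const_mul, ← h]
  ring

/-- The weight of the variance parameter `s` in the representation of the law of the sum of `m`
edges as a mixture of centred Gaussian densities. -/
def mixtureWeight (m : ℕ) (s : ℝ) : ℝ :=
  s ^ ((m : ℝ) - 5 / 2) * Real.exp (-s) / (Real.Gamma m * (16 * Real.pi) ^ (3 / 2 : ℝ))

/-- The radial density of the sum of `m` independent Hopf-Gaussian edges. -/
def sumDensity (m : ℕ) (r : ℝ) : ℝ :=
  ∫ s in Ioi (0 : ℝ), mixtureWeight m s * Real.exp (-(16 * s)⁻¹ * r ^ 2)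

/-- The radial density of a single Hopf-Gaussian edge. -/
def edgeDensity (r : ℝ) : ℝ := Real.exp (-(r / 2)) / (16 * Real.pi * r)

theorem mixtureWeight_nonneg (m : ℕ) {s : ℝ} (hs : 0 < s) : 0 ≤ mixtureWeight m s := by
  have : 0 ≤ Real.Gamma m := Real.Gamma_nonneg_of_nonneg (by positivity)
  unfold mixtureWeight
  positivity

theorem sumDensity_nonneg (m : ℕ) (r : ℝ) : 0 ≤ sumDensity m r :=
  setIntegral_nonneg measurableSet_Ioi fun _ hs =>
    mul_nonneg (mixtureWeight_nonneg m hs) (Real.exp_pos _).le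

theorem edgeDensity_nonneg {r : ℝ} (hr : 0 ≤ r) : 0 ≤ edgeDensity r := by
  unfold edgeDensity
  positivity

@[fun_prop]
theorem measurable_mixtureWeight (m : ℕ) : Measurable (mixtureWeight m) := by
  unfold mixtureWeight
  fun_prop

@[fun_prop]
theorem measurable_edgeDensity : Measurable edgeDensity := by
  unfold edgeDensity
  fun_prop

@[fun_prop]
theorem measurable_sumDensity (m : ℕ) : Measurable (sumDensity m) := by
  have : Measurable (fun p : ℝ × ℝ => mixtureWeight m p.2 * Real.exp (-(16 * p.2)⁻¹ * p.1 ^ 2)) := by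
    fun_prop
  exact (this.stronglyMeasurable.integral_prod_right
    (ν := volume.restrict (Ioi (0 : ℝ)))).measurable

theorem sumDensity_eq_besselK {m : ℕ} (hm : 1 ≤ m) {r : ℝ} (hr : 0 < r) :
    sumDensity m r = 2 * (r / 4) ^ ((m : ℝ) - 3 / 2) * besselK ((m : ℝ) - 3 / 2) (r / 2) /
      (Real.Gamma m * (16 * Real.pi) ^ (3 / 2 : ℝ)) := by
  have hm' : (1 : ℝ) ≤ m := by exact_mod_cast hm
  have h := integral_rpow_mul_exp_neg_add_div (ν := (m : ℝ) - 3 / 2) (u := r / 2)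
    (by linarith) (by positivity)
  rw [show r / 2 / 2 = r / 4 by ring] at h
  rw [← h, ← integral_div, sumDensity]
  refine setIntegral_congr_fun measurableSet_Ioi fun s hs => ?_
  have hs : 0 < s := hs
  simp only [mixtureWeight]
  rw [show (m : ℝ) - 3 / 2 - 1 = m - 5 / 2 by ring,
    show -(s + (r / 4) ^ 2 / s) = -s + -(16 * s)⁻¹ * r ^ 2 by field_simp; ring, Real.exp_add]
  ring

theorem sumDensity_one {r : ℝ} (hr : 0 < r) : sumDensity 1 r = edgeDensity r := by
  have hpi := Real.pi_pos
  rw [sumDensity_eq_besselK le_rfl hr, show ((1 : ℕ) : ℝ) - 3 / 2 = -1 / 2 by norm_num,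
    besselK_neg_half, edgeDensity]
  have h1 : Real.sqrt (Real.pi / (2 * (r / 2))) = Real.sqrt Real.pi / Real.sqrt r := by
    rw [show 2 * (r / 2) = r by ring, Real.sqrt_div hpi.le]
  have h2 : (r / 4) ^ (-1 / 2 : ℝ) = 2 / Real.sqrt r := by
    rw [show (-1 / 2 : ℝ) = -(1 / 2) by norm_num, Real.rpow_neg (by positivity),
      ← Real.sqrt_eq_rpow, Real.sqrt_div hr.le, show (4 : ℝ) = 2 ^ 2 by norm_num,
      Real.sqrt_sq (by norm_num), inv_div]
  have h3 : (16 * Real.pi) ^ (3 / 2 : ℝ) = 16 * Real.pi * (4 * Real.sqrt Real.pi) := by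
    rw [show (3 / 2 : ℝ) = 1 + 1 / 2 by norm_num, Real.rpow_add (by positivity), Real.rpow_one,
      ← Real.sqrt_eq_rpow, Real.sqrt_mul (by norm_num), show (16 : ℝ) = 4 ^ 2 by norm_num,
      Real.sqrt_sq (by norm_num)]
  have hsp : 0 < Real.sqrt r := Real.sqrt_pos.2 hr
  have hspi : 0 < Real.sqrt Real.pi := Real.sqrt_pos.2 hpi
  rw [h1, h2, h3]
  simp only [Nat.cast_one, Real.Gamma_one]
  field_simp
  rw [Real.sq_sqrt hr.le]
  ring

theorem integrableOn_mixtureWeight {m : ℕ} (hm : 2 ≤ m) : IntegrableOn (mixtureWeight m) (Ioi 0) := by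
  have hm' : (2 : ℝ) ≤ m := by exact_mod_cast hm
  have h := (Real.GammaIntegral_convergent (s := (m : ℝ) - 3 / 2) (by linarith)).div_const
    (Real.Gamma m * (16 * Real.pi) ^ (3 / 2 : ℝ))
  refine h.congr (Eventually.of_forall fun s => ?_)
  simp only [mixtureWeight]
  ring_nf

theorem sumDensity_zero {m : ℕ} (hm : 2 ≤ m) :
    sumDensity m 0 = Real.Gamma ((m : ℝ) - 3 / 2) /
      (Real.Gamma m * (16 * Real.pi) ^ (3 / 2 : ℝ)) := by
  have hm' : (2 : ℝ) ≤ m := by exact_mod_cast hm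
  rw [Real.Gamma_eq_integral (by linarith), ← integral_div, sumDensity]
  congr 1
  ext s
  simp only [mixtureWeight]
  ring_nf
  simp

theorem sumDensity_zero_pos {m : ℕ} (hm : 2 ≤ m) : 0 < sumDensity m 0 := by
  have hm' : (2 : ℝ) ≤ m := by exact_mod_cast hm
  have h1 : 0 < Real.Gamma ((m : ℝ) - 3 / 2) := Real.Gamma_pos_of_pos (by linarith)
  have h2 : 0 < Real.Gamma (m : ℝ) := Real.Gamma_pos_of_pos (by linarith)
  rw [sumDensity_zero hm]
  positivity

theorem mixture_integrand_le (m : ℕ) {s : ℝ} (hs : 0 < s) (r : ℝ) :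
    ‖mixtureWeight m s * Real.exp (-(16 * s)⁻¹ * r ^ 2)‖ ≤ mixtureWeight m s := by
  have h := mixtureWeight_nonneg m hs
  rw [Real.norm_of_nonneg (mul_nonneg h (Real.exp_pos _).le)]
  refine mul_le_of_le_one_right h (Real.exp_le_one_iff.2 ?_)
  have : 0 ≤ (16 * s)⁻¹ * r ^ 2 := by positivity
  linarith

@[fun_prop]
theorem continuous_sumDensity {m : ℕ} (hm : 2 ≤ m) : Continuous (sumDensity m) := by
  refine continuous_of_dominated (bound := mixtureWeight m) (fun r => ?_) (fun r => ?_)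
    (integrableOn_mixtureWeight hm) (Eventually.of_forall fun s => by fun_prop)
  · exact Measurable.aestronglyMeasurable (by fun_prop)
  · filter_upwards [ae_restrict_mem measurableSet_Ioi] with s hs
    exact mixture_integrand_le m hs r

theorem sumDensity_le {m : ℕ} (hm : 2 ≤ m) (r : ℝ) : sumDensity m r ≤ sumDensity m 0 := by
  have h := integrableOn_mixtureWeight hm
  have key : ∀ r : ℝ, IntegrableOn (fun s => mixtureWeight m s * Real.exp (-(16 * s)⁻¹ * r ^ 2))
      (Ioi 0) := fun r => by
    refine Integrable.mono' h (Measurable.aestronglyMeasurable (by fun_prop)) ?_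
    filter_upwards [ae_restrict_mem measurableSet_Ioi] with s hs
    exact mixture_integrand_le m hs r
  refine setIntegral_mono_on (key r) (key 0) measurableSet_Ioi fun s hs => ?_
  simpa using (le_abs_self _).trans (mixture_integrand_le m hs r)

theorem integrable_uncurry_mixture {m : ℕ} (hm : 1 ≤ m) (t : E3) :
    Integrable (Function.uncurry fun (x : E3) (s : ℝ) =>
      Complex.exp (inner ℝ x t * Complex.I) *
        ((mixtureWeight m s * Real.exp (-(16 * s)⁻¹ * ‖x‖ ^ 2) : ℝ) : ℂ))
      ((volume : Measure E3).prod (volume.restrict (Ioi (0 : ℝ)))) := by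
  have hm' : (1 : ℝ) ≤ m := by exact_mod_cast hm
  have hmeas : Measurable (Function.uncurry fun (x : E3) (s : ℝ) =>
      Complex.exp (inner ℝ x t * Complex.I) *
        ((mixtureWeight m s * Real.exp (-(16 * s)⁻¹ * ‖x‖ ^ 2) : ℝ) : ℂ)) := by
    simp only [Function.uncurry_def]
    fun_prop
  have hnorm : ∀ (x : E3), ∀ s ∈ Ioi (0 : ℝ), ‖Complex.exp (inner ℝ x t * Complex.I) *
        ((mixtureWeight m s * Real.exp (-(16 * s)⁻¹ * ‖x‖ ^ 2) : ℝ) : ℂ)‖ =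
        mixtureWeight m s * Real.exp (-(16 * s)⁻¹ * ‖x‖ ^ 2) := fun x s hs => by
    rw [norm_mul, Complex.norm_exp_ofReal_mul_I, one_mul, Complex.norm_real, Real.norm_of_nonneg
      (mul_nonneg (mixtureWeight_nonneg m hs) (Real.exp_pos _).le)]
  rw [integrable_prod_iff' hmeas.aestronglyMeasurable]
  constructor
  · filter_upwards [ae_restrict_mem measurableSet_Ioi] with s hs
    have hs' : 0 < s := hs
    have hg : Integrable (fun x : E3 => Real.exp (-(16 * s)⁻¹ * ‖x‖ ^ 2)) := by
      by_contra H
      have h := GaussianFourier.integral_rexp_neg_mul_sq_norm (V := E3) (b := (16 * s)⁻¹)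
        (by positivity)
      rw [integral_undef H] at h
      have : 0 < (Real.pi / (16 * s)⁻¹) ^ ((Module.finrank ℝ E3 : ℝ) / 2) := by positivity
      linarith
    refine (hg.const_mul (mixtureWeight m s)).mono
      (hmeas.comp (measurable_id.prodMk measurable_const)).aestronglyMeasurable
      (Eventually.of_forall fun x => ?_)
    refine ((hnorm x s hs).trans ?_).le
    rw [Real.norm_of_nonneg (mul_nonneg (mixtureWeight_nonneg m hs) (Real.exp_pos _).le)]
  · have h := (Real.GammaIntegral_convergent (s := (m : ℝ)) (by linarith)).div_const (Real.Gamma m)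
    refine h.congr ?_
    filter_upwards [ae_restrict_mem measurableSet_Ioi] with s hs
    have hs' : 0 < s := hs
    have hpi := Real.pi_pos
    simp only [Function.uncurry_apply_pair, hnorm _ s hs]
    rw [integral_const_mul, GaussianFourier.integral_rexp_neg_mul_sq_norm (by positivity),
      mixtureWeight, finrank_euclideanSpace_fin, div_inv_eq_mul,
      show Real.pi * (16 * s) = (16 * Real.pi) * s by ring,
      Real.mul_rpow (by positivity) hs'.le]
    have h1 : s ^ ((m : ℝ) - 1) = s ^ ((m : ℝ) - 5 / 2) * s ^ (((3 : ℕ) : ℝ) / 2) := by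
      rw [← Real.rpow_add hs']; congr 1; push_cast; ring
    have h2 : (0 : ℝ) < (16 * Real.pi) ^ (3 / 2 : ℝ) := by positivity
    rw [h1]
    push_cast
    field_simp

theorem integral_cexp_mul_sumDensity {m : ℕ} (hm : 1 ≤ m) (t : E3) :
    ∫ x : E3, Complex.exp (inner ℝ x t * Complex.I) * (sumDensity m ‖x‖ : ℂ) =
      ((((1 + 4 * ‖t‖ ^ 2) ^ m)⁻¹ : ℝ) : ℂ) := by
  have hm' : (1 : ℝ) ≤ m := by exact_mod_cast hm
  have hpi := Real.pi_pos
  have hG : 0 < Real.Gamma m := Real.Gamma_pos_of_pos (by linarith)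
  have h1 : ∀ x : E3, Complex.exp (inner ℝ x t * Complex.I) * (sumDensity m ‖x‖ : ℂ) =
      ∫ s in Ioi (0 : ℝ), Complex.exp (inner ℝ x t * Complex.I) *
        ((mixtureWeight m s * Real.exp (-(16 * s)⁻¹ * ‖x‖ ^ 2) : ℝ) : ℂ) := fun x => by
    rw [integral_const_mul, sumDensity, integral_complex_ofReal]
  have h2 : ∀ s ∈ Ioi (0 : ℝ), ∫ x : E3, Complex.exp (inner ℝ x t * Complex.I) *
        ((mixtureWeight m s * Real.exp (-(16 * s)⁻¹ * ‖x‖ ^ 2) : ℝ) : ℂ) =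
      ((s ^ ((m : ℝ) - 1) * Real.exp (-((1 + 4 * ‖t‖ ^ 2) * s)) / Real.Gamma m : ℝ) : ℂ) := by
    intro s hs
    have hs : 0 < s := hs
    have hre : 0 < ((((16 * s)⁻¹ : ℝ)) : ℂ).re := by rw [Complex.ofReal_re]; positivity
    have h := GaussianFourier.integral_cexp_neg_mul_sq_norm_add hre Complex.I t
    have h3 : ∀ x : E3, Complex.exp (inner ℝ x t * Complex.I) *
        ((mixtureWeight m s * Real.exp (-(16 * s)⁻¹ * ‖x‖ ^ 2) : ℝ) : ℂ) =
        (mixtureWeight m s : ℂ) * Complex.exp (-(((16 * s)⁻¹ : ℝ) : ℂ) * (‖x‖ : ℂ) ^ 2 +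
          Complex.I * (inner ℝ t x : ℝ)) := fun x => by
      rw [real_inner_comm, Complex.exp_add]
      push_cast
      ring_nf
    simp only [h3]
    rw [integral_const_mul, h, finrank_euclideanSpace_fin, Complex.I_sq]
    have h4 : ((Real.pi : ℂ) / (((16 * s)⁻¹ : ℝ) : ℂ)) ^ (((3 : ℕ) : ℂ) / 2) =
        (((Real.pi * (16 * s)) ^ (3 / 2 : ℝ) : ℝ) : ℂ) := by
      rw [Complex.ofReal_cpow (by positivity)]
      push_cast
      rw [div_inv_eq_mul]
    have h5 : Complex.exp (-1 * (‖t‖ : ℂ) ^ 2 / (4 * (((16 * s)⁻¹ : ℝ) : ℂ))) =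
        ((Real.exp (-(4 * ‖t‖ ^ 2 * s)) : ℝ) : ℂ) := by
      rw [Complex.ofReal_exp]
      congr 1
      push_cast
      field_simp
      ring
    rw [h4, h5, ← Complex.ofReal_mul, ← Complex.ofReal_mul]
    congr 1
    rw [show Real.pi * (16 * s) = (16 * Real.pi) * s by ring,
      Real.mul_rpow (by positivity) hs.le, mixtureWeight,
      show -((1 + 4 * ‖t‖ ^ 2) * s) = -s + -(4 * ‖t‖ ^ 2 * s) by ring, Real.exp_add]
    have h6 : s ^ ((m : ℝ) - 1) = s ^ ((m : ℝ) - 5 / 2) * s ^ (3 / 2 : ℝ) := by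
      rw [← Real.rpow_add hs]; congr 1; ring
    have h7 : (0 : ℝ) < (16 * Real.pi) ^ (3 / 2 : ℝ) := by positivity
    rw [h6]
    field_simp
  simp only [h1]
  rw [integral_integral_swap (integrable_uncurry_mixture hm t),
    setIntegral_congr_fun measurableSet_Ioi h2, integral_complex_ofReal, integral_div,
    Real.integral_rpow_mul_exp_neg_mul_Ioi (by linarith) (by positivity),
    mul_div_cancel_right₀ _ hG.ne', Real.rpow_natCast, one_div, inv_pow]

theorem integrable_sumDensity {m : ℕ} (hm : 1 ≤ m) :
    Integrable (fun x : E3 => sumDensity m ‖x‖) := by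
  have h := (integrable_uncurry_mixture hm 0).integral_prod_left
  refine h.re.congr (Eventually.of_forall fun x => ?_)
  simp only [Function.uncurry_apply_pair, inner_zero_right, Complex.ofReal_zero, zero_mul,
    Complex.exp_zero, one_mul, integral_complex_ofReal]
  simp [sumDensity]

/-- The measure on `ℝ³` with radial density `sumDensity m`. -/
def sumLaw (m : ℕ) : Measure E3 :=
  (volume : Measure E3).withDensity fun x => ENNReal.ofReal (sumDensity m ‖x‖)

theorem isFiniteMeasure_sumLaw {m : ℕ} (hm : 1 ≤ m) : IsFiniteMeasure (sumLaw m) :=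
  isFiniteMeasure_withDensity_ofReal (integrable_sumDensity hm).2

theorem charFun_sumLaw {m : ℕ} (hm : 1 ≤ m) (t : E3) :
    charFun (sumLaw m) t = ((((1 + 4 * ‖t‖ ^ 2) ^ m)⁻¹ : ℝ) : ℂ) := by
  rw [charFun_apply, sumLaw, integral_withDensity_eq_integral_toReal_smul (by fun_prop) (by simp),
    ← integral_cexp_mul_sumDensity hm]
  congr 1
  ext x
  rw [ENNReal.toReal_ofReal (sumDensity_nonneg _ _), Complex.real_smul, mul_comm]

theorem sumLaw_one : sumLaw 1 =
    (volume : Measure E3).withDensity fun x => ENNReal.ofReal (edgeDensity ‖x‖) := by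
  refine withDensity_congr_ae ?_
  filter_upwards [compl_mem_ae_iff.2 (measure_singleton (0 : E3))] with x hx
  rw [sumDensity_one (norm_pos_iff.2 hx)]

theorem hopf_quat (q : Fin 4 → ℝ) :
    hopf (quat q) = !₂[q 0 ^ 2 + q 1 ^ 2 - q 2 ^ 2 - q 3 ^ 2,
      2 * (q 1 * q 2 - q 0 * q 3), 2 * (q 1 * q 3 + q 0 * q 2)] := by
  have h0 : ∀ q, (quat q).re = q 0 := fun _ => rfl
  have h1 : ∀ q, (quat q).imI = q 1 := fun _ => rfl
  have h2 : ∀ q, (quat q).imJ = q 2 := fun _ => rfl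
  have h3 : ∀ q, (quat q).imK = q 3 := fun _ => rfl
  ext i
  fin_cases i <;> simp [hopf, h0, h1, h2, h3] <;> ring

@[fun_prop]
theorem continuous_hopf_quat : Continuous fun q : Fin 4 → ℝ => hopf (quat q) := by
  simp only [hopf_quat]
  refine (PiLp.continuous_toLp 2 _).comp (continuous_pi fun i => ?_)
  fin_cases i <;> simp <;> fun_prop

/-- The law of a single Hopf-Gaussian edge. -/
def hopfLaw : Measure E3 :=
  (Measure.pi fun _ : Fin 4 => gaussianReal 0 1).map fun q => hopf (quat q)

instance : IsProbabilityMeasure hopfLaw :=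
  Measure.isProbabilityMeasure_map continuous_hopf_quat.aemeasurable

theorem hopfGaussianArm_eq_pi (n : ℕ) : hopfGaussianArm n = Measure.pi fun _ => hopfLaw := by
  unfold hopfGaussianArm gaussianHn hopfLaw
  rw [← Measure.pi_map_pi (fun _ => continuous_hopf_quat.aemeasurable)]

theorem integral_pi_succ {n : ℕ} {X : Type*} [MeasurableSpace X] (μ : Measure X) [SigmaFinite μ]
    {F : (Fin (n + 1) → X) → ℂ} (hF : Integrable F (Measure.pi fun _ => μ)) :
    ∫ q, F q ∂(Measure.pi fun _ => μ) =
      ∫ x, ∫ q, F (Fin.cons x q) ∂(Measure.pi fun _ => μ) ∂μ := by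
  have h := (measurePreserving_piFinSuccAbove (fun _ : Fin (n + 1) => μ) 0).symm
  rw [← h.integral_comp', integral_prod]
  · simp [MeasurableEquiv.piFinSuccAbove, Fin.insertNthEquiv]
  · exact (h.integrable_comp_emb (MeasurableEquiv.measurableEmbedding _)).2 hF

theorem integral_cexp_quadratic_gaussianReal {b : ℂ} (hb : b.re ≤ 0) (c d : ℂ) :
    ∫ x, Complex.exp (b * x ^ 2 + c * x + d) ∂(gaussianReal 0 1) =
      ((Real.sqrt (2 * Real.pi))⁻¹ : ℝ) * (Real.pi / (1 / 2 - b)) ^ (1 / 2 : ℂ) *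
        Complex.exp (d + c ^ 2 / (2 * (1 - 2 * b))) := by
  have hb' : (b - 1 / 2).re < 0 := by simp; linarith
  have h0 : 1 - 2 * b ≠ 0 := fun h => by
    have := congrArg Complex.re h
    simp at this
    linarith
  have h1 : b - 1 / 2 ≠ 0 := fun h => h0 (by linear_combination (-2) * h)
  rw [integral_gaussianReal_eq_integral_smul one_ne_zero]
  have h2 : ∀ x : ℝ, gaussianPDFReal 0 1 x • Complex.exp (b * x ^ 2 + c * x + d) =
      ((Real.sqrt (2 * Real.pi))⁻¹ : ℝ) *
        Complex.exp ((b - 1 / 2) * x ^ 2 + c * x + d) := fun x => by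
    rw [Complex.real_smul, gaussianPDFReal]
    simp only [NNReal.coe_one, mul_one, sub_zero]
    rw [Complex.ofReal_mul, mul_assoc, Complex.ofReal_exp, ← Complex.exp_add]
    congr 2
    push_cast
    ring
  simp only [h2]
  rw [integral_const_mul, integral_cexp_quadratic hb', neg_sub, mul_assoc]
  congr 3
  rw [sub_eq_add_neg]
  congr 1
  have h3 : (4 * (b - 1 / 2)) = -(2 * (1 - 2 * b)) := by ring
  rw [h3, div_neg, neg_neg]

theorem gaussian_prefactor_sq (b : ℂ) :
    (((Real.sqrt (2 * Real.pi))⁻¹ : ℝ) * (Real.pi / (1 / 2 - b)) ^ (1 / 2 : ℂ) : ℂ) ^ 2 =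
      (1 - 2 * b)⁻¹ := by
  have hpi : (Real.pi : ℂ) ≠ 0 := by exact_mod_cast Real.pi_ne_zero
  have h1 : (((Real.pi : ℂ) / (1 / 2 - b)) ^ (1 / 2 : ℂ)) ^ 2 = Real.pi / (1 / 2 - b) := by
    rw [← Complex.cpow_nat_mul]; norm_num
  rw [mul_pow, h1, ← Complex.ofReal_pow, inv_pow, Real.sq_sqrt (by positivity)]
  push_cast
  rw [show 1 - 2 * b = 2 * (1 / 2 - b) by ring, mul_inv, mul_inv]
  field_simp

theorem integral_cexp_pi_four {f : ℝ → ℝ → ℝ → ℝ → ℝ}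
    (hf : Continuous fun p : ℝ × ℝ × ℝ × ℝ => f p.1 p.2.1 p.2.2.1 p.2.2.2) :
    ∫ q, Complex.exp (f (q 0) (q 1) (q 2) (q 3) * Complex.I)
        ∂(Measure.pi fun _ : Fin 4 => gaussianReal 0 1) =
      ∫ a, ∫ b, ∫ c, ∫ d, Complex.exp (f a b c d * Complex.I)
        ∂(gaussianReal 0 1) ∂(gaussianReal 0 1) ∂(gaussianReal 0 1) ∂(gaussianReal 0 1) := by
  have hintegrable : ∀ {n : ℕ} (g : (Fin n → ℝ) → ℝ), Continuous g →
      Integrable (fun q => Complex.exp (g q * Complex.I))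
        (Measure.pi fun _ : Fin n => gaussianReal 0 1) := fun g hg =>
    (integrable_const (1 : ℝ)).mono' (by fun_prop)
      (Eventually.of_forall fun q => (Complex.norm_exp_ofReal_mul_I _).le)
  refine (integral_pi_succ _ (hintegrable (fun q => f (q 0) (q 1) (q 2) (q 3))
    (hf.comp (f := fun q : Fin 4 → ℝ => (q 0, q 1, q 2, q 3)) (by fun_prop)))).trans ?_
  refine integral_congr_ae (Eventually.of_forall fun a => ?_)
  simp only
  refine (integral_pi_succ _ (hintegrable (fun q => f a (q 0) (q 1) (q 2))
    (hf.comp (f := fun q : Fin 3 → ℝ => (a, q 0, q 1, q 2)) (by fun_prop)))).trans ?_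
  refine integral_congr_ae (Eventually.of_forall fun b => ?_)
  simp only
  refine (integral_pi_succ _ (hintegrable (fun q => f a b (q 0) (q 1))
    (hf.comp (f := fun q : Fin 2 → ℝ => (a, b, q 0, q 1)) (by fun_prop)))).trans ?_
  refine integral_congr_ae (Eventually.of_forall fun c => ?_)
  simp only
  refine (integral_pi_succ _ (hintegrable (fun q => f a b c (q 0))
    (hf.comp (f := fun q : Fin 1 → ℝ => (a, b, c, q 0)) (by fun_prop)))).trans ?_
  simp

theorem charFun_hopfLaw (t : E3) :
    charFun hopfLaw t = (((1 + 4 * ‖t‖ ^ 2)⁻¹ : ℝ) : ℂ) := by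
  rw [charFun_apply, hopfLaw, integral_map continuous_hopf_quat.aemeasurable (by fun_prop)]
  have hin : ∀ q : Fin 4 → ℝ, inner ℝ (hopf (quat q)) t =
      (q 0 ^ 2 + q 1 ^ 2 - q 2 ^ 2 - q 3 ^ 2) * t 0 + 2 * (q 1 * q 2 - q 0 * q 3) * t 1 +
        2 * (q 1 * q 3 + q 0 * q 2) * t 2 := fun q => by
    rw [hopf_quat]
    simp [PiLp.inner_apply, Fin.sum_univ_three]
    ring
  simp only [hin]
  rw [integral_cexp_pi_four (f := fun a b c d => (a ^ 2 + b ^ 2 - c ^ 2 - d ^ 2) * t 0 +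
    2 * (b * c - a * d) * t 1 + 2 * (b * d + a * c) * t 2) (by fun_prop)]
  set I := Complex.I
  set x : ℂ := ((t 0 : ℝ) : ℂ) with hx
  set y : ℂ := ((t 1 : ℝ) : ℂ) with hy
  set z : ℂ := ((t 2 : ℝ) : ℂ) with hz
  have hI : I ^ 2 = -1 := Complex.I_sq
  set w : ℂ := 1 + 2 * I * x with hw
  have hw0 : w ≠ 0 := fun h => by
    have := congrArg Complex.re h
    simp [hw, hx, I] at this
  have hre1 : (-(I * x)).re ≤ 0 := by simp [I, hx]
  set β : ℂ := I * x - 2 * (y ^ 2 + z ^ 2) / w with hβ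
  have hre2 : β.re ≤ 0 := by
    have h1 : β = I * x - ((2 * (t 1 ^ 2 + t 2 ^ 2) / (1 + 4 * t 0 ^ 2) : ℝ) : ℂ) *
        (1 - 2 * I * x) := by
      have h2 : w * (1 - 2 * I * x) = ((1 + 4 * t 0 ^ 2 : ℝ) : ℂ) := by
        push_cast
        rw [hw, ← hx]
        linear_combination (-4 * x ^ 2) * hI
      have h3 : ((1 + 4 * t 0 ^ 2 : ℝ) : ℂ) ≠ 0 := by
        have : (0 : ℝ) < 1 + 4 * t 0 ^ 2 := by positivity
        exact_mod_cast this.ne'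
      rw [Complex.ofReal_div, ← h2]
      rw [← h2] at h3
      rw [hβ, div_mul_eq_mul_div, mul_div_mul_right _ _ (right_ne_zero_of_mul h3)]
      push_cast
      rfl
    have hk : 0 ≤ 2 * (t 1 ^ 2 + t 2 ^ 2) / (1 + 4 * t 0 ^ 2) := by positivity
    rw [h1]
    generalize 2 * (t 1 ^ 2 + t 2 ^ 2) / (1 + 4 * t 0 ^ 2) = k at hk
    simpa [I, hx] using hk
  have hint_last : ∀ a b c : ℝ, ∫ d, Complex.exp ((((a ^ 2 + b ^ 2 - c ^ 2 - d ^ 2) * t 0 +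
      2 * (b * c - a * d) * t 1 + 2 * (b * d + a * c) * t 2 : ℝ) : ℂ) * I) ∂(gaussianReal 0 1) =
      (((Real.sqrt (2 * Real.pi))⁻¹ : ℝ) * (Real.pi / (1 / 2 - -(I * x))) ^ (1 / 2 : ℂ)) *
      Complex.exp (-(I * x) * c ^ 2 + (2 * I * (b * y + a * z)) * c +
        ((a ^ 2 + b ^ 2) * x * I - 2 * (b * z - a * y) ^ 2 / w)) := by
    intro a b c
    have h := integral_cexp_quadratic_gaussianReal hre1 (2 * I * (b * z - a * y))
      ((a ^ 2 + b ^ 2 - c ^ 2) * x * I + (2 * b * c * y + 2 * a * c * z) * I)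
    rw [show 1 - 2 * -(I * x) = w by rw [hw]; ring] at h
    have e : (-(I * x) * (c : ℂ) ^ 2 + (2 * I * (b * y + a * z)) * c +
        ((a ^ 2 + b ^ 2) * x * I - 2 * (b * z - a * y) ^ 2 / w)) =
      ((a ^ 2 + b ^ 2 - c ^ 2) * x * I + (2 * b * c * y + 2 * a * c * z) * I) +
        (2 * I * (b * z - a * y)) ^ 2 / (2 * w) := by
      field_simp
      linear_combination (-2 * (b * z - a * y) ^ 2) * hI
    rw [e, ← h]
    congr 1
    ext d
    congr 1
    push_cast
    rw [← hx, ← hy, ← hz]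
    ring
  have hint_third : ∀ a b : ℝ, ∫ c, Complex.exp (-(I * x) * (c : ℂ) ^ 2 + (2 * I * (b * y + a * z)) * c +
        ((a ^ 2 + b ^ 2) * x * I - 2 * (b * z - a * y) ^ 2 / w)) ∂(gaussianReal 0 1) =
      (((Real.sqrt (2 * Real.pi))⁻¹ : ℝ) * (Real.pi / (1 / 2 - -(I * x))) ^ (1 / 2 : ℂ)) *
      Complex.exp (β * b ^ 2 + 0 * b + β * a ^ 2) := by
    intro a b
    rw [integral_cexp_quadratic_gaussianReal hre1, show 1 - 2 * -(I * x) = w by rw [hw]; ring]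
    congr 2
    rw [hβ]
    field_simp
    linear_combination (2 * (b * y + a * z) ^ 2) * hI
  have hint_second : ∀ a : ℝ, ∫ b, Complex.exp (β * (b : ℂ) ^ 2 + 0 * b + β * a ^ 2) ∂(gaussianReal 0 1) =
      (((Real.sqrt (2 * Real.pi))⁻¹ : ℝ) * (Real.pi / (1 / 2 - β)) ^ (1 / 2 : ℂ)) *
      Complex.exp (β * a ^ 2 + 0 * a + 0) := by
    intro a
    rw [integral_cexp_quadratic_gaussianReal hre2]
    simp
  simp only [hint_last, integral_const_mul, hint_third, hint_second]
  rw [integral_cexp_quadratic_gaussianReal hre2]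
  have k1 := gaussian_prefactor_sq (-(I * x))
  have k2 := gaussian_prefactor_sq β
  set A : ℂ := ((Real.sqrt (2 * Real.pi))⁻¹ : ℝ) * (Real.pi / (1 / 2 - -(I * x))) ^ (1 / 2 : ℂ)
  set B : ℂ := ((Real.sqrt (2 * Real.pi))⁻¹ : ℝ) * (Real.pi / (1 / 2 - β)) ^ (1 / 2 : ℂ)
  have e1 : A * (A * (B * (B * Complex.exp (0 + 0 ^ 2 / (2 * (1 - 2 * β)))))) = A ^ 2 * B ^ 2 := by
    simp
    ring
  rw [e1, k1, k2, ← mul_inv, Complex.ofReal_inv]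
  congr 1
  rw [EuclideanSpace.norm_sq_eq, Fin.sum_univ_three]
  push_cast
  simp only [Real.norm_eq_abs, ← Complex.ofReal_pow, sq_abs]
  push_cast
  rw [← hx, ← hy, ← hz, hβ, show 1 - 2 * -(I * x) = w by rw [hw]; ring]
  field_simp
  rw [hw]
  linear_combination (-4 * x ^ 2) * hI

theorem map_sum_pi_hopfLaw {m : ℕ} (hm : 1 ≤ m) :
    (Measure.pi fun _ : Fin m => hopfLaw).map (fun e => ∑ i, e i) = sumLaw m := by
  have := isFiniteMeasure_sumLaw hm
  have : IsProbabilityMeasure ((Measure.pi fun _ : Fin m => hopfLaw).map (fun e => ∑ i, e i)) :=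
    Measure.isProbabilityMeasure_map (by fun_prop)
  refine Measure.ext_of_charFun ?_
  rw [charFun_map_sum_pi_eq_prod]
  ext t
  rw [Finset.prod_apply, charFun_sumLaw hm]
  simp [charFun_hopfLaw]

theorem hopfLaw_eq : hopfLaw =
    (volume : Measure E3).withDensity fun x => ENNReal.ofReal (edgeDensity ‖x‖) := by
  have := isFiniteMeasure_sumLaw le_rfl
  rw [← sumLaw_one]
  refine Measure.ext_of_charFun ?_
  ext t
  rw [charFun_hopfLaw, charFun_sumLaw le_rfl, pow_one]

theorem eventually_le_ball_average {φ : E3 → ℝ≥0∞} {x : E3} (hφ : φ x ≤ liminf φ (𝓝 x))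
    {c : ℝ≥0∞} (hc : c < φ x) :
    ∀ᶠ ε in 𝓝[>] (0 : ℝ),
      c ≤ (∫⁻ y in Metric.ball x ε, φ y) / volume (Metric.ball x ε) := by
  obtain ⟨δ, hδ, hb⟩ := Metric.eventually_nhds_iff_ball.1
    (eventually_lt_of_lt_liminf (hc.trans_le hφ))
  filter_upwards [Ioo_mem_nhdsGT hδ] with ε hε
  rw [ENNReal.le_div_iff_mul_le (.inl (Metric.measure_ball_pos _ _ hε.1).ne')
    (.inl measure_ball_lt_top.ne), ← setLIntegral_const]
  exact setLIntegral_mono' measurableSet_ball fun y hy =>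
    (hb y (Metric.ball_subset_ball hε.2.le hy)).le

theorem tendsto_ball_average {φ : E3 → ℝ≥0∞} {x : E3} (hφ : ContinuousAt φ x) :
    Tendsto (fun ε : ℝ => (∫⁻ y in Metric.ball x ε, φ y) / volume (Metric.ball x ε))
      (𝓝[>] 0) (𝓝 (φ x)) := by
  refine tendsto_order.2 ⟨fun c hc => ?_, fun c hc => ?_⟩
  · obtain ⟨d, hcd, hd⟩ := exists_between hc
    filter_upwards [eventually_le_ball_average hφ.tendsto.liminf_eq.ge hd] with ε hε
    exact hcd.trans_le hε
  · obtain ⟨d, hd, hcd⟩ := exists_between hc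
    obtain ⟨δ, hδ, hb⟩ := Metric.eventually_nhds_iff_ball.1 (hφ.eventually_lt_const hd)
    filter_upwards [Ioo_mem_nhdsGT hδ] with ε hε
    refine lt_of_le_of_lt ?_ hcd
    refine ENNReal.div_le_of_le_mul ?_
    rw [← setLIntegral_const]
    exact setLIntegral_mono' measurableSet_ball fun y hy =>
      (hb y (Metric.ball_subset_ball hε.2.le hy)).le

/-- The arm with last `N` edges `e` and with first edge chosen so that the edges sum to `s`. -/
def completeArm {N : ℕ} (s : E3) (e : Arm N) : Arm (N + 1) := Fin.cons (s - ∑ i, e i) e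

theorem sum_completeArm {N : ℕ} (s : E3) (e : Arm N) : ∑ i, completeArm s e i = s := by
  simp [completeArm, Fin.sum_univ_succ]

theorem continuous_uncurry_completeArm {N : ℕ} :
    Continuous fun p : E3 × Arm N => completeArm p.1 p.2 := by
  refine continuous_pi fun i => ?_
  refine Fin.cases ?_ (fun j => ?_) i
  · simp only [completeArm, Fin.cons_zero]
    fun_prop
  · simp only [completeArm, Fin.cons_succ]
    fun_prop

theorem lintegral_hopfGaussianArm_succ {N : ℕ} {φ : Arm (N + 1) → ℝ≥0∞} (hφ : Measurable φ) :
    ∫⁻ e, φ e ∂(hopfGaussianArm (N + 1)) = ∫⁻ s : E3, ∫⁻ e : Arm N,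
      φ (completeArm s e) * ENNReal.ofReal (edgeDensity ‖s - ∑ i, e i‖) ∂(hopfGaussianArm N) := by
  simp only [hopfGaussianArm_eq_pi]
  have h := (measurePreserving_piFinSuccAbove (fun _ : Fin (N + 1) => hopfLaw) 0).symm
  have hcons : ∀ p : E3 × Arm N,
      (MeasurableEquiv.piFinSuccAbove (fun _ : Fin (N + 1) => E3) 0).symm p = Fin.cons p.1 p.2 :=
    fun p => by simp [MeasurableEquiv.piFinSuccAbove, Fin.insertNthEquiv]
  have hm : Measurable fun p : E3 × Arm N => φ (Fin.cons p.1 p.2) := by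
    have := hφ.comp (MeasurableEquiv.piFinSuccAbove (fun _ : Fin (N + 1) => E3) 0).symm.measurable
    simpa only [Function.comp_def, hcons] using this
  have hm' : Measurable fun p : E3 × Arm N => φ (completeArm p.1 p.2) :=
    hφ.comp continuous_uncurry_completeArm.measurable
  rw [← h.lintegral_comp hφ]
  simp only [hcons]
  rw [lintegral_prod_symm' _ hm]
  symm
  rw [lintegral_lintegral_swap]
  · refine lintegral_congr fun e => ?_
    symm
    have he : Measurable fun x : E3 => φ (Fin.cons x e) :=
      hm.comp (measurable_id.prodMk measurable_const)
    rw [hopfLaw_eq, lintegral_withDensity_eq_lintegral_mul _ (by fun_prop) he,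
      ← lintegral_sub_right_eq_self _ (∑ i, e i)]
    refine lintegral_congr fun s => ?_
    simp only [Pi.mul_apply, completeArm]
    rw [mul_comm]
  · refine (hm'.mul ?_).aemeasurable
    fun_prop

theorem lintegral_edgeDensity_sub_sum {N : ℕ} (hN : 1 ≤ N) (s : E3) :
    ∫⁻ e : Arm N, ENNReal.ofReal (edgeDensity ‖s - ∑ i, e i‖) ∂(hopfGaussianArm N) =
      ∫⁻ x : E3, ENNReal.ofReal (sumDensity N ‖s - x‖) ∂hopfLaw := by
  have h1 : ∫⁻ e : Arm N, ENNReal.ofReal (edgeDensity ‖s - ∑ i, e i‖) ∂(hopfGaussianArm N) =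
      ∫⁻ x, ENNReal.ofReal (edgeDensity ‖s - x‖) ∂(sumLaw N) := by
    rw [← map_sum_pi_hopfLaw hN, lintegral_map (by fun_prop) (by fun_prop), hopfGaussianArm_eq_pi]
  rw [h1, sumLaw, lintegral_withDensity_eq_lintegral_mul _ (by fun_prop) (by fun_prop),
    ← lintegral_sub_left_eq_self _ s, hopfLaw_eq,
    lintegral_withDensity_eq_lintegral_mul _ (by fun_prop) (by fun_prop)]
  refine lintegral_congr fun x => ?_
  simp only [Pi.mul_apply, sub_sub_cancel]
  rw [mul_comm]

theorem continuous_lintegral_edgeDensity_sub_sum {N : ℕ} (hN : 2 ≤ N) :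
    Continuous fun s : E3 =>
      ∫⁻ e : Arm N, ENNReal.ofReal (edgeDensity ‖s - ∑ i, e i‖) ∂(hopfGaussianArm N) := by
  simp only [lintegral_edgeDensity_sub_sum (by omega : 1 ≤ N)]
  refine continuous_iff_continuousAt.2 fun s => ?_
  refine tendsto_lintegral_filter_of_dominated_convergence
    (fun _ => ENNReal.ofReal (sumDensity N 0)) (Eventually.of_forall fun s => by fun_prop)
    (Eventually.of_forall fun s => Eventually.of_forall fun x =>
      ENNReal.ofReal_le_ofReal (sumDensity_le hN _)) (by simp)
    (Eventually.of_forall fun x => ?_)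
  have := continuous_sumDensity hN
  exact Continuous.tendsto (f := fun s => ENNReal.ofReal (sumDensity N ‖s - x‖))
    (ENNReal.continuous_ofReal.comp (by fun_prop)) s

/-- The tube of arms whose end-to-end vector is shorter than `ε`. -/
def tube (n : ℕ) (ε : ℝ) : Set (Arm n) := {e | ‖∑ i, e i‖ < ε}

theorem isOpen_tube (n : ℕ) (ε : ℝ) : IsOpen (tube n ε) :=
  isOpen_lt (by fun_prop) continuous_const

theorem hopfGaussianArm_tube_inter {N : ℕ} {G : Set (Arm (N + 1))} (hG : MeasurableSet G) (ε : ℝ) :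
    hopfGaussianArm (N + 1) (tube (N + 1) ε ∩ G) = ∫⁻ s in Metric.ball (0 : E3) ε, ∫⁻ e : Arm N,
      G.indicator 1 (completeArm s e) * ENNReal.ofReal (edgeDensity ‖s - ∑ i, e i‖)
        ∂(hopfGaussianArm N) := by
  have hA := (isOpen_tube (N + 1) ε).measurableSet.inter hG
  rw [← lintegral_indicator_one hA, lintegral_hopfGaussianArm_succ (measurable_one.indicator hA),
    ← lintegral_indicator measurableSet_ball]
  refine lintegral_congr fun s => ?_
  by_cases hs : s ∈ Metric.ball (0 : E3) ε
  · rw [indicator_of_mem hs]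
    refine lintegral_congr fun e => ?_
    have : completeArm s e ∈ tube (N + 1) ε := by simpa [tube, sum_completeArm] using hs
    congr 1
    by_cases hg : completeArm s e ∈ G
    · rw [indicator_of_mem hg, indicator_of_mem (Set.mem_inter this hg)]
    · rw [indicator_of_notMem hg, indicator_of_notMem fun h => hg h.2]
  · rw [indicator_of_notMem hs]
    refine (lintegral_congr fun e => ?_).trans lintegral_zero
    have : completeArm s e ∉ tube (N + 1) ε := by simpa [tube, sum_completeArm] using hs
    simp [this]

theorem hopfGaussianArm_tube {n : ℕ} (hn : 1 ≤ n) (ε : ℝ) :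
    hopfGaussianArm n (tube n ε) = sumLaw n (Metric.ball 0 ε) := by
  rw [← map_sum_pi_hopfLaw hn, Measure.map_apply (by fun_prop) measurableSet_ball,
    hopfGaussianArm_eq_pi]
  congr 1
  ext e
  simp [tube]

theorem tendsto_sumLaw_ball {m : ℕ} (hm : 2 ≤ m) (x : E3) :
    Tendsto (fun ε : ℝ => sumLaw m (Metric.ball x ε) / volume (Metric.ball x ε)) (𝓝[>] 0)
      (𝓝 (ENNReal.ofReal (sumDensity m ‖x‖))) := by
  have := continuous_sumDensity hm
  have h := tendsto_ball_average (φ := fun x : E3 => ENNReal.ofReal (sumDensity m ‖x‖)) (x := x)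
    (ENNReal.continuous_ofReal.comp (by fun_prop)).continuousAt
  refine h.congr fun ε => ?_
  rw [sumLaw, withDensity_apply _ measurableSet_ball]

theorem lintegral_edgeDensity_neg_sum {N : ℕ} (hN : 2 ≤ N) :
    ∫⁻ e : Arm N, ENNReal.ofReal (edgeDensity ‖(0 : E3) - ∑ i, e i‖) ∂(hopfGaussianArm N) =
      ENNReal.ofReal (sumDensity (N + 1) 0) := by
  have h1 := tendsto_ball_average (x := (0 : E3))
    (continuous_lintegral_edgeDensity_sub_sum hN).continuousAt
  have h2 := tendsto_sumLaw_ball (m := N + 1) (by omega) 0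
  rw [norm_zero] at h2
  refine tendsto_nhds_unique h1 (h2.congr fun ε => ?_)
  rw [← hopfGaussianArm_tube (by omega), ← inter_univ (tube (N + 1) ε),
    hopfGaussianArm_tube_inter MeasurableSet.univ]
  simp

theorem lintegral_indicator_completeArm_le_liminf {N : ℕ} {G : Set (Arm (N + 1))} (hG : IsOpen G) :
    ∫⁻ e : Arm N, G.indicator 1 (completeArm 0 e) *
        ENNReal.ofReal (edgeDensity ‖(0 : E3) - ∑ i, e i‖) ∂(hopfGaussianArm N) ≤
      liminf (fun s : E3 => ∫⁻ e : Arm N, G.indicator 1 (completeArm s e) *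
        ENNReal.ofReal (edgeDensity ‖s - ∑ i, e i‖) ∂(hopfGaussianArm N)) (𝓝 0) := by
  refine le_trans (lintegral_mono fun e => ?_) (lintegral_liminf_le fun s => ?_)
  · have hc : Continuous fun s : E3 => completeArm s e :=
      continuous_uncurry_completeArm.comp (by fun_prop : Continuous fun s : E3 => (s, e))
    by_cases he : completeArm 0 e ∈ G ∧ (0 : E3) - ∑ i, e i ≠ 0
    · refine (Tendsto.liminf_eq ?_).ge
      have h0 : ‖(0 : E3) - ∑ i, e i‖ ≠ 0 := norm_ne_zero_iff.2 he.2
      have h1 : ContinuousAt (fun s : E3 => ENNReal.ofReal (edgeDensity ‖s - ∑ i, e i‖)) 0 := by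
        unfold edgeDensity
        refine ENNReal.continuous_ofReal.continuousAt.comp (ContinuousAt.div (by fun_prop)
          (by fun_prop) (mul_ne_zero (by positivity) h0))
      simp only [indicator_of_mem he.1, Pi.one_apply, one_mul]
      refine h1.tendsto.congr' ?_
      filter_upwards [hc.continuousAt.preimage_mem_nhds (hG.mem_nhds he.1)] with s hs
      rw [indicator_of_mem (show completeArm s e ∈ G from hs)]
      simp
    · rw [not_and_or, not_not] at he
      have : G.indicator 1 (completeArm 0 e) *
          ENNReal.ofReal (edgeDensity ‖(0 : E3) - ∑ i, e i‖) = 0 := by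
        rcases he with he | he
        · simp [he]
        · rw [he]
          simp [edgeDensity]
      rw [this]
      exact zero_le
  · refine Measurable.mul ?_ (by fun_prop)
    exact (measurable_one.indicator hG.measurableSet).comp
      (continuous_uncurry_completeArm.comp (by fun_prop : Continuous fun e => (s, e))).measurable

instance (n : ℕ) : IsProbabilityMeasure (hopfGaussianArm n) := by
  rw [hopfGaussianArm_eq_pi]
  infer_instance

theorem measurableSet_closedPolygons (n : ℕ) : MeasurableSet (closedPolygons n) :=
  measurableSet_eq_fun (by fun_prop) measurable_const

theorem completeArm_zero_mem {N : ℕ} (e : Arm N) : completeArm 0 e ∈ closedPolygons (N + 1) :=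
  sum_completeArm 0 e

/-- The Hopf-Gaussian measure on closed polygons, in the coordinates given by all edges but the
first. -/
def polygonMeasure (N : ℕ) : Measure (closedPolygons (N + 1)) :=
  ((ENNReal.ofReal (sumDensity (N + 1) 0))⁻¹ • (hopfGaussianArm N).withDensity
    fun e => ENNReal.ofReal (edgeDensity ‖(0 : E3) - ∑ i, e i‖)).map
    fun e => ⟨completeArm 0 e, completeArm_zero_mem e⟩

theorem measurable_completeArm_zero {N : ℕ} :
    Measurable fun e : Arm N => completeArm 0 e :=
  (continuous_uncurry_completeArm.comp
    (by fun_prop : Continuous fun e : Arm N => ((0 : E3), e))).measurable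

theorem map_val_polygonMeasure_apply {N : ℕ} {G : Set (Arm (N + 1))} (hG : MeasurableSet G) :
    (polygonMeasure N).map Subtype.val G = (∫⁻ e : Arm N, G.indicator 1 (completeArm 0 e) *
        ENNReal.ofReal (edgeDensity ‖(0 : E3) - ∑ i, e i‖) ∂(hopfGaussianArm N)) /
      ENNReal.ofReal (sumDensity (N + 1) 0) := by
  have hm := measurable_completeArm_zero (N := N)
  rw [polygonMeasure, Measure.map_map measurable_subtype_coe (hm.subtype_mk),
    Measure.map_apply (measurable_subtype_coe.comp hm.subtype_mk) hG, Measure.smul_apply,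
    smul_eq_mul, mul_comm, div_eq_mul_inv]
  congr 1
  have hG' : MeasurableSet ((fun e : Arm N => completeArm 0 e) ⁻¹' G) := hm hG
  refine (withDensity_apply _ hG').trans ?_
  rw [← lintegral_indicator hG']
  refine lintegral_congr fun e => ?_
  by_cases he : completeArm 0 e ∈ G
  · rw [indicator_of_mem (show e ∈ (fun e : Arm N => completeArm 0 e) ⁻¹' G from he),
      indicator_of_mem he]
    simp
  · rw [indicator_of_notMem (show e ∉ (fun e : Arm N => completeArm 0 e) ⁻¹' G from he),
      indicator_of_notMem he]
    simp

theorem isProbabilityMeasure_polygonMeasure {N : ℕ} (hN : 2 ≤ N) :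
    IsProbabilityMeasure (polygonMeasure N) := by
  have h := map_val_polygonMeasure_apply (N := N) MeasurableSet.univ
  rw [Measure.map_apply measurable_subtype_coe MeasurableSet.univ, preimage_univ] at h
  refine ⟨h.trans ?_⟩
  simp only [indicator_univ, Pi.one_apply, one_mul]
  rw [lintegral_edgeDensity_neg_sum hN]
  exact ENNReal.div_self (by simpa using sumDensity_zero_pos (by omega)) ENNReal.ofReal_ne_top

theorem tendsto_hopfGaussianArm_tube {n : ℕ} (hn : 2 ≤ n) :
    Tendsto (fun ε : ℝ => hopfGaussianArm n (tube n ε) / volume (Metric.ball (0 : E3) ε)) (𝓝[>] 0)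
      (𝓝 (ENNReal.ofReal (sumDensity n 0))) := by
  have h := tendsto_sumLaw_ball hn 0
  rw [norm_zero] at h
  exact h.congr fun ε => by rw [hopfGaussianArm_tube (by omega)]

theorem eventually_hopfGaussianArm_tube_ne_zero {n : ℕ} (hn : 2 ≤ n) :
    ∀ᶠ ε in 𝓝[>] (0 : ℝ), hopfGaussianArm n (tube n ε) ≠ 0 := by
  filter_upwards [(tendsto_hopfGaussianArm_tube hn).eventually_ne
    (by simpa using sumDensity_zero_pos hn : ENNReal.ofReal (sumDensity n 0) ≠ 0)] with ε hε h
  exact hε (by simp [h])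

theorem map_val_polygonMeasure_le_liminf {N : ℕ} (hN : 2 ≤ N) {G : Set (Arm (N + 1))}
    (hG : IsOpen G) :
    (polygonMeasure N).map Subtype.val G ≤
      liminf (fun ε : ℝ => cond (hopfGaussianArm (N + 1)) (tube (N + 1) ε) G) (𝓝[>] 0) := by
  rw [map_val_polygonMeasure_apply hG.measurableSet]
  have hg := sumDensity_zero_pos (m := N + 1) (by omega)
  set g := ENNReal.ofReal (sumDensity (N + 1) 0) with hgdef
  have hg0 : g ≠ 0 := by simpa [hgdef] using hg
  have hgt : g ≠ ∞ := ENNReal.ofReal_ne_top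
  refine le_of_forall_lt fun c hc => ?_
  obtain ⟨c₁, hcc, hc₁⟩ := exists_between hc
  refine hcc.trans_le (le_liminf_of_le (by isBoundedDefault) ?_)
  have hc₁t : c₁ ≠ ∞ := hc₁.ne_top
  have hmul : c₁ * g < _ := (ENNReal.lt_div_iff_mul_lt (.inl hg0) (.inl hgt)).1 hc₁
  obtain ⟨d, hd₁, hd₂⟩ := exists_between hmul
  have ha : Tendsto (fun ε : ℝ => c₁ * (hopfGaussianArm (N + 1) (tube (N + 1) ε) /
      volume (Metric.ball (0 : E3) ε))) (𝓝[>] 0) (𝓝 (c₁ * g)) :=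
    ENNReal.Tendsto.const_mul (tendsto_hopfGaussianArm_tube (by omega)) (.inr hc₁t)
  have hb := eventually_le_ball_average (lintegral_indicator_completeArm_le_liminf hG) hd₂
  filter_upwards [ha.eventually_lt_const hd₁, hb,
    eventually_hopfGaussianArm_tube_ne_zero (n := N + 1) (by omega),
    self_mem_nhdsWithin] with ε h1 h2 h3 hε
  have hv0 : volume (Metric.ball (0 : E3) ε) ≠ 0 := (Metric.measure_ball_pos _ _ hε).ne'
  have hvt : volume (Metric.ball (0 : E3) ε) ≠ ∞ := measure_ball_lt_top.ne
  rw [← hopfGaussianArm_tube_inter hG.measurableSet] at h2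
  have h4 := h1.le.trans h2
  rw [← mul_div_assoc, ENNReal.div_le_iff hv0 hvt, ENNReal.div_mul_cancel hv0 hvt] at h4
  rw [cond_apply (isOpen_tube _ _).measurableSet, mul_comm, ← div_eq_mul_inv,
    ENNReal.le_div_iff_mul_le (.inl h3) (.inl (measure_ne_top _ _))]
  exact h4

theorem isHopfGaussianPolygonMeasure_polygonMeasure {N : ℕ} (hN : 2 ≤ N) :
    IsHopfGaussianPolygonMeasure (N + 1) (polygonMeasure N) := by
  have hprob := isProbabilityMeasure_polygonMeasure hN
  have hprob' : IsProbabilityMeasure ((polygonMeasure N).map Subtype.val) :=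
    Measure.isProbabilityMeasure_map measurable_subtype_coe.aemeasurable
  refine ⟨hprob, fun f => ?_⟩
  classical
  let μ₀ : ProbabilityMeasure (Arm (N + 1)) := ⟨(polygonMeasure N).map Subtype.val, hprob'⟩
  let μs : ℝ → ProbabilityMeasure (Arm (N + 1)) := fun ε =>
    if h : hopfGaussianArm (N + 1) (tube (N + 1) ε) ≠ 0 then
      ⟨cond (hopfGaussianArm (N + 1)) (tube (N + 1) ε), cond_isProbabilityMeasure h⟩ else μ₀
  have hev : ∀ᶠ ε in 𝓝[>] (0 : ℝ), (μs ε : Measure (Arm (N + 1))) =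
      cond (hopfGaussianArm (N + 1)) (tube (N + 1) ε) := by
    filter_upwards [eventually_hopfGaussianArm_tube_ne_zero (n := N + 1) (by omega)] with ε hε
    have : μs ε = ⟨_, cond_isProbabilityMeasure hε⟩ := dif_pos hε
    rw [this]
    rfl
  have hlim : Tendsto μs (𝓝[>] 0) (𝓝 μ₀) := by
    refine tendsto_of_forall_isOpen_le_liminf' fun G hG => ?_
    refine (map_val_polygonMeasure_le_liminf hN hG).trans_eq (liminf_congr ?_)
    filter_upwards [hev] with ε hε
    rw [hε]
  have h := ProbabilityMeasure.tendsto_iff_forall_integral_tendsto.1 hlim f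
  have h0 : ∫ e, f e ∂(μ₀ : Measure (Arm (N + 1))) =
      ∫ p : closedPolygons (N + 1), f p ∂(polygonMeasure N) :=
    integral_map measurable_subtype_coe.aemeasurable f.continuous.aestronglyMeasurable
  rw [h0] at h
  refine h.congr' ?_
  filter_upwards [hev] with ε hε
  rw [hε]
  rfl

theorem IsHopfGaussianPolygonMeasure.unique {n : ℕ} {μ ν : Measure (closedPolygons n)}
    (hμ : IsHopfGaussianPolygonMeasure n μ) (hν : IsHopfGaussianPolygonMeasure n ν) : μ = ν := by
  have := hμ.1
  have := hν.1
  have h : μ.map Subtype.val = ν.map Subtype.val := by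
    have := Measure.isProbabilityMeasure_map (μ := μ)
      (measurable_subtype_coe (p := (· ∈ closedPolygons n))).aemeasurable
    have := Measure.isProbabilityMeasure_map (μ := ν)
      (measurable_subtype_coe (p := (· ∈ closedPolygons n))).aemeasurable
    refine ext_of_forall_integral_eq_of_IsFiniteMeasure fun f => ?_
    rw [integral_map measurable_subtype_coe.aemeasurable f.continuous.aestronglyMeasurable,
      integral_map measurable_subtype_coe.aemeasurable f.continuous.aestronglyMeasurable]
    exact tendsto_nhds_unique (hμ.2 f) (hν.2 f)
  have he := MeasurableEmbedding.subtype_coe (measurableSet_closedPolygons n)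
  rw [← he.comap_map μ, h, he.comap_map]

theorem measurePreserving_pair_rest {M : ℕ} (hM : 1 ≤ M) {i j : Fin (M + 2)} (hij : i ≠ j) :
    MeasurePreserving (fun e : Arm (M + 2) => ((e i, e j), ∑ k, e k - e i - e j))
      (hopfGaussianArm (M + 2)) ((hopfLaw.prod hopfLaw).prod (sumLaw M)) := by
  have := isFiniteMeasure_sumLaw hM
  obtain ⟨j', rfl⟩ := Fin.exists_succAbove_eq hij.symm
  have h1 := measurePreserving_piFinSuccAbove (fun _ : Fin (M + 2) => hopfLaw) i
  have h2 := measurePreserving_piFinSuccAbove (fun _ : Fin (M + 1) => hopfLaw) j'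
  have h3 : MeasurePreserving (fun e : Arm M => ∑ k, e k) (Measure.pi fun _ => hopfLaw)
      (sumLaw M) := ⟨by fun_prop, map_sum_pi_hopfLaw hM⟩
  have h4 := (MeasurePreserving.id hopfLaw).prod
    (((MeasurePreserving.id hopfLaw).prod h3).comp h2)
  have h5 := ((measurePreserving_prodAssoc hopfLaw hopfLaw (sumLaw M)).symm.comp h4).comp h1
  rw [hopfGaussianArm_eq_pi]
  convert h5 using 1
  ext e : 1
  have hs : ∑ k, e k = e i + (e (i.succAbove j') + ∑ k, e (i.succAbove (j'.succAbove k))) := by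
    rw [Fin.sum_univ_succAbove _ i, Fin.sum_univ_succAbove _ j']
  rw [hs]
  simp [MeasurableEquiv.piFinSuccAbove, Fin.insertNthEquiv, MeasurableEquiv.prodAssoc,
    Fin.removeNth]

theorem integral_tube_pair {M : ℕ} (hM : 1 ≤ M) {i j : Fin (M + 2)} (hij : i ≠ j)
    (g : E3 × E3 →ᵇ ℝ) (ε : ℝ) :
    ∫ e in tube (M + 2) ε, g (e i, e j) ∂(hopfGaussianArm (M + 2)) =
      ∫ p : E3 × E3, g p * (sumLaw M).real (Metric.ball (-(p.1 + p.2)) ε)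
        ∂(hopfLaw.prod hopfLaw) := by
  have := isFiniteMeasure_sumLaw hM
  have hT := measurePreserving_pair_rest hM hij
  let S : Set ((E3 × E3) × E3) := {q | q.2 ∈ Metric.ball (-(q.1.1 + q.1.2)) ε}
  have hS : MeasurableSet S := by
    have : IsOpen S := isOpen_lt (f := fun q : (E3 × E3) × E3 => dist q.2 (-(q.1.1 + q.1.2)))
      (by fun_prop) continuous_const
    exact this.measurableSet
  have hpre : tube (M + 2) ε =
      (fun e : Arm (M + 2) => ((e i, e j), ∑ k, e k - e i - e j)) ⁻¹' S := by
    ext e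
    simp only [tube, S, mem_preimage, Metric.mem_ball, dist_eq_norm, mem_ofPred_eq]
    rw [show ∑ k, e k - e i - e j - -(e i + e j) = ∑ k, e k by abel]
  have hg : Measurable fun q : (E3 × E3) × E3 => g q.1 := g.continuous.measurable.comp measurable_fst
  have h1 : ∫ q in S, g q.1 ∂((hopfLaw.prod hopfLaw).prod (sumLaw M)) =
      ∫ e in tube (M + 2) ε, g (e i, e j) ∂(hopfGaussianArm (M + 2)) := by
    rw [← hT.map_eq, setIntegral_map hS hg.aestronglyMeasurable hT.measurable.aemeasurable, hpre]
  rw [← h1, ← integral_indicator hS, integral_prod]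
  · refine integral_congr_ae (Eventually.of_forall fun p => ?_)
    have : ∀ s : E3, S.indicator (fun q : (E3 × E3) × E3 => g q.1) (p, s) =
        (Metric.ball (-(p.1 + p.2)) ε).indicator (fun _ => g p) s := fun s => rfl
    simp only [this]
    rw [integral_indicator measurableSet_ball, setIntegral_const, smul_eq_mul, mul_comm]
  · refine Integrable.indicator ?_ hS
    exact (integrable_const ‖g‖).mono' hg.aestronglyMeasurable
      (Eventually.of_forall fun q => g.norm_coe_le_norm _)

theorem sumLaw_ball_le {m : ℕ} (hm : 2 ≤ m) (x : E3) (ε : ℝ) :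
    sumLaw m (Metric.ball x ε) ≤ ENNReal.ofReal (sumDensity m 0) * volume (Metric.ball x ε) := by
  rw [sumLaw, withDensity_apply _ measurableSet_ball, ← setLIntegral_const]
  exact lintegral_mono fun y => ENNReal.ofReal_le_ofReal (sumDensity_le hm _)

theorem tendsto_integral_cond_pair {M : ℕ} (hM : 2 ≤ M) {i j : Fin (M + 2)} (hij : i ≠ j)
    (g : E3 × E3 →ᵇ ℝ) :
    Tendsto (fun ε : ℝ => ∫ e, g (e i, e j) ∂(cond (hopfGaussianArm (M + 2)) (tube (M + 2) ε)))
      (𝓝[>] 0) (𝓝 ((sumDensity (M + 2) 0)⁻¹ *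
        ∫ p : E3 × E3, g p * sumDensity M ‖p.1 + p.2‖ ∂(hopfLaw.prod hopfLaw))) := by
  have := isFiniteMeasure_sumLaw (by omega : 1 ≤ M)
  have hg0 := sumDensity_zero_pos (m := M + 2) (by omega)
  have h1 : Tendsto (fun ε : ℝ => (hopfGaussianArm (M + 2)).real (tube (M + 2) ε) /
      volume.real (Metric.ball (0 : E3) ε)) (𝓝[>] 0) (𝓝 (sumDensity (M + 2) 0)) := by
    have h := (ENNReal.tendsto_toReal ENNReal.ofReal_ne_top).comp
      (tendsto_hopfGaussianArm_tube (n := M + 2) (by omega))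
    rw [ENNReal.toReal_ofReal hg0.le] at h
    exact h.congr fun ε => ENNReal.toReal_div _ _
  have h2 : Tendsto (fun ε : ℝ => ∫ p : E3 × E3, g p * ((sumLaw M).real
      (Metric.ball (-(p.1 + p.2)) ε) / volume.real (Metric.ball (0 : E3) ε))
      ∂(hopfLaw.prod hopfLaw)) (𝓝[>] 0)
      (𝓝 (∫ p : E3 × E3, g p * sumDensity M ‖p.1 + p.2‖ ∂(hopfLaw.prod hopfLaw))) := by
    refine tendsto_integral_filter_of_dominated_convergence (fun _ => ‖g‖ * sumDensity M 0)
      (Eventually.of_forall fun ε => ?_) ?_ (integrable_const _) (Eventually.of_forall fun p => ?_)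
    · refine g.continuous.aestronglyMeasurable.mul ?_
      have hm : Measurable fun x : E3 => sumLaw M (Metric.ball x ε) := by
        have hS : MeasurableSet {q : E3 × E3 | q.2 ∈ Metric.ball q.1 ε} := by
          have : IsOpen {q : E3 × E3 | q.2 ∈ Metric.ball q.1 ε} :=
            isOpen_lt (f := fun q : E3 × E3 => dist q.2 q.1) (by fun_prop) continuous_const
          exact this.measurableSet
        exact measurable_measure_prodMk_left hS
      have hm' : Measurable fun p : E3 × E3 => sumLaw M (Metric.ball (-(p.1 + p.2)) ε) :=
        hm.comp (by fun_prop)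
      exact (hm'.ennreal_toReal.div_const _).aestronglyMeasurable
    · filter_upwards [self_mem_nhdsWithin] with ε hε
      refine Eventually.of_forall fun p => ?_
      have hv0 : 0 < volume.real (Metric.ball (0 : E3) ε) :=
        ENNReal.toReal_pos (Metric.measure_ball_pos _ _ hε).ne' measure_ball_lt_top.ne
      rw [norm_mul]
      refine mul_le_mul (g.norm_coe_le_norm _) ?_ (norm_nonneg _) (norm_nonneg _)
      rw [Real.norm_of_nonneg (by positivity), div_le_iff₀ hv0]
      have h := ENNReal.toReal_mono (by finiteness) (sumLaw_ball_le hM (-(p.1 + p.2)) ε)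
      rw [ENNReal.toReal_mul, ENNReal.toReal_ofReal (sumDensity_nonneg _ _),
        Measure.addHaar_ball_center volume] at h
      exact h
    · refine Tendsto.const_mul _ ?_
      have h := (ENNReal.tendsto_toReal ENNReal.ofReal_ne_top).comp
        (tendsto_sumLaw_ball hM (-(p.1 + p.2)))
      rw [ENNReal.toReal_ofReal (sumDensity_nonneg _ _), norm_neg] at h
      refine h.congr fun ε => ?_
      simp only [Function.comp, ENNReal.toReal_div, Measure.addHaar_ball_center volume (-(p.1 + p.2))]
      rfl
  refine ((h1.inv₀ hg0.ne').mul h2).congr' ?_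
  filter_upwards [self_mem_nhdsWithin] with ε hε
  have hv0 : 0 < volume.real (Metric.ball (0 : E3) ε) :=
    ENNReal.toReal_pos (Metric.measure_ball_pos _ _ hε).ne' measure_ball_lt_top.ne
  rw [ProbabilityTheory.cond, integral_smul_measure, integral_tube_pair (by omega) hij,
    ENNReal.toReal_inv, smul_eq_mul]
  simp only [← mul_div_assoc]
  rw [integral_div]
  change _ = ((hopfGaussianArm (M + 2)).real (tube (M + 2) ε))⁻¹ * _
  field_simp

theorem IsHopfGaussianPolygonMeasure.map_pair {M : ℕ} (hM : 2 ≤ M) {i j : Fin (M + 2)}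
    (hij : i ≠ j) {μ : Measure (closedPolygons (M + 2))}
    (hμ : IsHopfGaussianPolygonMeasure (M + 2) μ) :
    μ.map (fun p => (p.1 i, p.1 j)) = (volume : Measure (E3 × E3)).withDensity fun p =>
      ENNReal.ofReal (edgeDensity ‖p.1‖ * edgeDensity ‖p.2‖ *
        (sumDensity M ‖p.1 + p.2‖ / sumDensity (M + 2) 0)) := by
  have := hμ.1
  have hmeas : Measurable fun p : closedPolygons (M + 2) => (p.1 i, p.1 j) :=
    ((measurable_pi_apply i).comp measurable_subtype_coe).prodMk
      ((measurable_pi_apply j).comp measurable_subtype_coe)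
  have := Measure.isProbabilityMeasure_map (μ := μ) hmeas.aemeasurable
  have hg0 := sumDensity_zero_pos (m := M + 2) (by omega)
  let d : E3 × E3 → ℝ := fun p => sumDensity M ‖p.1 + p.2‖ / sumDensity (M + 2) 0
  have hd0 : ∀ p, 0 ≤ d p := fun p => div_nonneg (sumDensity_nonneg _ _) hg0.le
  have hdm : Measurable d := by fun_prop
  have hdi : Integrable d (hopfLaw.prod hopfLaw) :=
    (integrable_const (sumDensity M 0 / sumDensity (M + 2) 0)).mono' hdm.aestronglyMeasurable
      (Eventually.of_forall fun p => by
        rw [Real.norm_of_nonneg (hd0 p)]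
        exact div_le_div_of_nonneg_right (sumDensity_le hM _) hg0.le)
  have := isFiniteMeasure_withDensity_ofReal hdi.2
  have key : μ.map (fun p => (p.1 i, p.1 j)) =
      (hopfLaw.prod hopfLaw).withDensity fun p => ENNReal.ofReal (d p) := by
    refine ext_of_forall_integral_eq_of_IsFiniteMeasure fun g => ?_
    rw [integral_map hmeas.aemeasurable g.continuous.aestronglyMeasurable,
      integral_withDensity_eq_integral_toReal_smul (by fun_prop) (by simp)]
    have hlim := hμ.2 (g.compContinuous ⟨fun e : Arm (M + 2) => (e i, e j), by fun_prop⟩)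
    refine (tendsto_nhds_unique hlim (tendsto_integral_cond_pair hM hij g)).trans ?_
    rw [← integral_const_mul]
    refine integral_congr_ae (Eventually.of_forall fun p => ?_)
    simp only [ENNReal.toReal_ofReal (hd0 p), d, smul_eq_mul]
    ring
  rw [key, hopfLaw_eq, prod_withDensity (by fun_prop) (by fun_prop), ← withDensity_mul _
    (by fun_prop) (by fun_prop)]
  congr 1
  ext p
  simp only [Pi.mul_apply, d]
  rw [← ENNReal.ofReal_mul (edgeDensity_nonneg (norm_nonneg _)), ← ENNReal.ofReal_mul
    (mul_nonneg (edgeDensity_nonneg (norm_nonneg _)) (edgeDensity_nonneg (norm_nonneg _)))]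

theorem lintegral_sq_add_sq {k : ℝ → ℝ≥0∞} (hk : Measurable k) :
    ∫⁻ p : ℝ × ℝ, k (p.1 ^ 2 + p.2 ^ 2) =
      ENNReal.ofReal (2 * Real.pi) * ∫⁻ ρ in Ioi (0 : ℝ), ENNReal.ofReal ρ * k (ρ ^ 2) := by
  rw [← lintegral_comp_polarCoord_symm, polarCoord_target, Measure.volume_eq_prod,
    ← Measure.prod_restrict]
  have h1 : ∀ p : ℝ × ℝ, ENNReal.ofReal p.1 • k ((polarCoord.symm p).1 ^ 2 +
      (polarCoord.symm p).2 ^ 2) = ENNReal.ofReal p.1 * k (p.1 ^ 2) := fun p => by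
    rw [smul_eq_mul, polarCoord_symm_apply]
    congr 2
    linear_combination p.1 ^ 2 * Real.sin_sq_add_cos_sq p.2
  simp only [h1]
  rw [lintegral_prod _ (by fun_prop), ← lintegral_const_mul _ (by fun_prop)]
  refine lintegral_congr fun ρ => ?_
  simp only [lintegral_const, Measure.restrict_apply MeasurableSet.univ, univ_inter, Real.volume_Ioo]
  rw [mul_comm]
  congr 2
  ring

theorem lintegral_halfPlane_polar {k : ℝ × ℝ → ℝ≥0∞} :
    ∫⁻ p in {p : ℝ × ℝ | 0 < p.2}, k p =
      ∫⁻ p in Ioi (0 : ℝ) ×ˢ Ioo 0 Real.pi,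
        ENNReal.ofReal p.1 * k (p.1 * Real.cos p.2, p.1 * Real.sin p.2) := by
  have hm : MeasurableSet {p : ℝ × ℝ | 0 < p.2} := measurableSet_lt measurable_const measurable_snd
  rw [← lintegral_indicator hm, ← lintegral_comp_polarCoord_symm,
    ← lintegral_indicator polarCoord.open_target.measurableSet,
    ← lintegral_indicator (measurableSet_Ioi.prod measurableSet_Ioo)]
  refine lintegral_congr fun p => ?_
  by_cases hp : p ∈ polarCoord.target
  · rw [indicator_of_mem hp]
    have hp' := hp
    rw [polarCoord_target] at hp'
    obtain ⟨h1, h2, h3⟩ := hp'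
    have h1 : 0 < p.1 := h1
    rw [polarCoord_symm_apply, smul_eq_mul]
    by_cases hq : 0 < p.2
    · rw [indicator_of_mem (show p ∈ Ioi (0 : ℝ) ×ˢ Ioo 0 Real.pi from ⟨h1, hq, h3⟩),
        indicator_of_mem]
      exact mul_pos h1 (Real.sin_pos_of_pos_of_lt_pi hq h3)
    · rw [indicator_of_notMem (show p ∉ Ioi (0 : ℝ) ×ˢ Ioo 0 Real.pi from fun h => hq h.2.1),
        indicator_of_notMem, mul_zero]
      intro h
      have h : 0 < p.1 * Real.sin p.2 := h
      have := Real.sin_nonpos_of_nonpos_of_neg_pi_le (not_lt.1 hq) h2.le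
      nlinarith
  · rw [indicator_of_notMem hp, indicator_of_notMem]
    rintro ⟨h1, h2, h3⟩
    exact hp (by rw [polarCoord_target]; exact ⟨h1, by linarith [Real.pi_pos], h3⟩)

theorem lintegral_euclideanSpace_three {k : E3 → ℝ≥0∞} (hk : Measurable k) :
    ∫⁻ w : E3, k w = ∫⁻ c : ℝ, ∫⁻ p : ℝ × ℝ, k !₂[c, p.1, p.2] := by
  have h1 := PiLp.volume_preserving_toLp (Fin 3)
  have h2 := (volume_preserving_piFinSuccAbove (fun _ : Fin 3 => ℝ) 0).symm
  have h3 := (volume_preserving_finTwoArrow ℝ).symm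
  have h4 := h1.comp (h2.comp ((MeasurePreserving.id (volume : Measure ℝ)).prod h3))
  rw [← h4.lintegral_comp hk]
  refine (lintegral_prod _ (hk.comp h4.measurable).aemeasurable).trans ?_
  refine lintegral_congr fun c => lintegral_congr fun p => ?_
  refine congrArg k ?_
  ext i
  fin_cases i <;> rfl

theorem exists_orthonormalBasis_zero_eq {u : E3} (hu : u ≠ 0) :
    ∃ b : OrthonormalBasis (Fin 3) ℝ E3, b 0 = ‖u‖⁻¹ • u := by
  have hv : Orthonormal ℝ (({0} : Set (Fin 3)).domRestrict fun _ => ‖u‖⁻¹ • u) := by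
    refine ⟨fun i => ?_, fun i j hij => absurd (Subsingleton.elim i j) hij⟩
    change ‖‖u‖⁻¹ • u‖ = 1
    rw [norm_smul, norm_inv, norm_norm, inv_mul_cancel₀ (norm_ne_zero_iff.2 hu)]
  obtain ⟨b, hb⟩ := hv.exists_orthonormalBasis_extension_of_card_eq (by simp)
  exact ⟨b, hb 0 rfl⟩

theorem lintegral_norm_angle {u : E3} (hu : u ≠ 0) {H : ℝ × ℝ → ℝ≥0∞} (hH : Measurable H) :
    ∫⁻ y : E3, H (‖y‖, InnerProductGeometry.angle u y) =
      ENNReal.ofReal (2 * Real.pi) * ∫⁻ p in Ioi (0 : ℝ) ×ˢ Ioo 0 Real.pi,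
        ENNReal.ofReal (p.1 ^ 2 * Real.sin p.2) * H p := by
  obtain ⟨b, hb⟩ := exists_orthonormalBasis_zero_eq hu
  have hu' : ‖u‖ ≠ 0 := norm_ne_zero_iff.2 hu
  let k : E3 → ℝ≥0∞ := fun w => H (‖w‖, Real.arccos (w 0 / ‖w‖))
  have hk : Measurable k := by fun_prop
  have h1 : ∀ y : E3, H (‖y‖, InnerProductGeometry.angle u y) = k (b.repr y) := fun y => by
    simp only [k, LinearIsometryEquiv.norm_map, b.repr_apply_apply, hb, InnerProductGeometry.angle,
      inner_smul_left, conj_trivial]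
    congr 3
    field_simp
  let K : ℝ × ℝ → ℝ≥0∞ := fun q => H (Real.sqrt (q.1 ^ 2 + q.2),
    Real.arccos (q.1 / Real.sqrt (q.1 ^ 2 + q.2)))
  have hK : Measurable K := by fun_prop
  have h2 : ∀ (c : ℝ) (p : ℝ × ℝ), k !₂[c, p.1, p.2] = K (c, p.1 ^ 2 + p.2 ^ 2) := fun c p => by
    simp only [k, K, EuclideanSpace.norm_eq, Fin.sum_univ_three]
    simp [add_assoc]
  simp only [h1]
  rw [b.measurePreserving_repr.lintegral_comp hk, lintegral_euclideanSpace_three hk]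
  simp only [h2]
  have h3 : ∀ c : ℝ, ∫⁻ p : ℝ × ℝ, K (c, p.1 ^ 2 + p.2 ^ 2) =
      ENNReal.ofReal (2 * Real.pi) * ∫⁻ ρ in Ioi (0 : ℝ), ENNReal.ofReal ρ * K (c, ρ ^ 2) :=
    fun c => lintegral_sq_add_sq (k := fun q => K (c, q)) (by fun_prop)
  have h4 : ∫⁻ c : ℝ, ∫⁻ ρ in Ioi (0 : ℝ), ENNReal.ofReal ρ * K (c, ρ ^ 2) =
      ∫⁻ p in {p : ℝ × ℝ | 0 < p.2}, ENNReal.ofReal p.2 * K (p.1, p.2 ^ 2) := by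
    have : {p : ℝ × ℝ | 0 < p.2} = univ ×ˢ Ioi 0 := by ext; simp
    rw [this, Measure.volume_eq_prod, ← Measure.prod_restrict, lintegral_prod _ (by fun_prop),
      Measure.restrict_univ]
  simp only [h3]
  rw [lintegral_const_mul _ (by fun_prop), h4, lintegral_halfPlane_polar]
  congr 1
  refine setLIntegral_congr_fun (measurableSet_Ioi.prod measurableSet_Ioo) fun p hp => ?_
  obtain ⟨hr, hθ, hθ'⟩ := hp
  have hr : 0 < p.1 := hr
  have h5 : Real.sqrt ((p.1 * Real.cos p.2) ^ 2 + (p.1 * Real.sin p.2) ^ 2) = p.1 := by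
    rw [show (p.1 * Real.cos p.2) ^ 2 + (p.1 * Real.sin p.2) ^ 2 = p.1 ^ 2 by
      linear_combination p.1 ^ 2 * Real.sin_sq_add_cos_sq p.2, Real.sqrt_sq hr.le]
  simp only [K, h5]
  rw [mul_div_cancel_left₀ _ hr.ne', Real.arccos_cos hθ.le hθ'.le, ← mul_assoc,
    ← ENNReal.ofReal_mul hr.le]
  congr 2
  ring

theorem lintegral_sin_Ioo : ∫⁻ θ in Ioo 0 Real.pi, ENNReal.ofReal (Real.sin θ) = 2 := by
  rw [← ofReal_integral_eq_lintegral_ofReal]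
  · rw [← integral_Ioc_eq_integral_Ioo, ← intervalIntegral.integral_of_le Real.pi_pos.le,
      integral_sin]
    norm_num
  · exact Real.continuous_sin.continuousOn.integrableOn_Icc.mono_set Ioo_subset_Icc_self
  · filter_upwards [ae_restrict_mem measurableSet_Ioo] with θ hθ
    exact (Real.sin_pos_of_mem_Ioo hθ).le

theorem lintegral_norm {k : ℝ → ℝ≥0∞} (hk : Measurable k) :
    ∫⁻ x : E3, k ‖x‖ = ENNReal.ofReal (4 * Real.pi) *
      ∫⁻ r in Ioi (0 : ℝ), ENNReal.ofReal (r ^ 2) * k r := by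
  have hu : (EuclideanSpace.single 0 1 : E3) ≠ 0 := by simp
  have h := lintegral_norm_angle hu (H := fun p => k p.1) (by fun_prop)
  have hc : ENNReal.ofReal (4 * Real.pi) = ENNReal.ofReal (2 * Real.pi) * 2 := by
    rw [show 4 * Real.pi = 2 * Real.pi * 2 by ring, ENNReal.ofReal_mul (by positivity)]
    simp
  simp only at h
  rw [h, Measure.volume_eq_prod, ← Measure.prod_restrict, lintegral_prod _ (by fun_prop),
    hc, mul_assoc]
  congr 1
  rw [← lintegral_const_mul _ (by fun_prop)]
  refine lintegral_congr fun r => ?_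
  have h1 : ∀ θ : ℝ, ENNReal.ofReal (r ^ 2 * Real.sin θ) * k r =
      (ENNReal.ofReal (r ^ 2) * k r) * ENNReal.ofReal (Real.sin θ) := fun θ => by
    rw [ENNReal.ofReal_mul (by positivity)]
    ring
  simp only [h1]
  rw [lintegral_const_mul _ (by fun_prop), lintegral_sin_Ioo, mul_comm]

@[fun_prop]
theorem measurable_angle : Measurable fun p : E3 × E3 => InnerProductGeometry.angle p.1 p.2 := by
  unfold InnerProductGeometry.angle
  fun_prop

theorem lintegral_norm_norm_angle {H : ℝ × ℝ × ℝ → ℝ≥0∞} (hH : Measurable H) :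
    ∫⁻ p : E3 × E3, H (‖p.1‖, ‖p.2‖, InnerProductGeometry.angle p.1 p.2) =
      ∫⁻ t in Ioi (0 : ℝ) ×ˢ Ioi (0 : ℝ) ×ˢ Ioo 0 Real.pi,
        ENNReal.ofReal (8 * Real.pi ^ 2 * (t.1 ^ 2 * t.2.1 ^ 2 * Real.sin t.2.2)) * H t := by
  have hpi := Real.pi_pos
  rw [Measure.volume_eq_prod, lintegral_prod _ (by fun_prop)]
  have h1 : ∀ᵐ x : E3, ∫⁻ y : E3, H (‖x‖, ‖y‖, InnerProductGeometry.angle x y) =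
      ENNReal.ofReal (2 * Real.pi) * ∫⁻ p in Ioi (0 : ℝ) ×ˢ Ioo 0 Real.pi,
        ENNReal.ofReal (p.1 ^ 2 * Real.sin p.2) * H (‖x‖, p) := by
    filter_upwards [compl_mem_ae_iff.2 (measure_singleton (0 : E3))] with x hx
    exact lintegral_norm_angle hx (H := fun p => H (‖x‖, p)) (by fun_prop)
  rw [lintegral_congr_ae h1, lintegral_norm (k := fun r => ENNReal.ofReal (2 * Real.pi) *
    ∫⁻ p in Ioi (0 : ℝ) ×ˢ Ioo 0 Real.pi, ENNReal.ofReal (p.1 ^ 2 * Real.sin p.2) * H (r, p))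
    (by fun_prop), Measure.volume_eq_prod ℝ (ℝ × ℝ), ← Measure.prod_restrict, lintegral_prod _
    (by fun_prop), ← lintegral_const_mul _ (by fun_prop)]
  refine lintegral_congr fun r => ?_
  rw [← mul_assoc, ← mul_assoc, ← lintegral_const_mul _ (by fun_prop)]
  refine lintegral_congr fun p => ?_
  rw [← ENNReal.ofReal_mul (by positivity), ← ENNReal.ofReal_mul (by positivity), ← mul_assoc,
    ← ENNReal.ofReal_mul (by positivity)]
  congr 2
  ring

theorem chord_sq_pos {r₁ r₂ θ : ℝ} (h₁ : 0 < r₁) (h₂ : 0 < r₂) (hθ : θ ∈ Ioo 0 Real.pi) :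
    0 < r₁ ^ 2 + r₂ ^ 2 + 2 * r₁ * r₂ * Real.cos θ := by
  have h : -1 < Real.cos θ := by
    rw [← Real.cos_pi]
    exact Real.cos_lt_cos_of_nonneg_of_le_pi hθ.1.le le_rfl hθ.2
  nlinarith [mul_pos (mul_pos h₁ h₂) (by linarith : 0 < Real.cos θ + 1), sq_nonneg (r₁ - r₂)]

theorem chord_pos {r₁ r₂ θ : ℝ} (h₁ : 0 < r₁) (h₂ : 0 < r₂) (hθ : θ ∈ Ioo 0 Real.pi) :
    0 < chord r₁ r₂ θ :=
  Real.sqrt_pos.2 (chord_sq_pos h₁ h₂ hθ)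

theorem norm_add_eq_chord (x y : E3) :
    ‖x + y‖ = chord ‖x‖ ‖y‖ (InnerProductGeometry.angle x y) := by
  rw [chord, ← Real.sqrt_sq (norm_nonneg (x + y)), norm_add_sq_real,
    ← InnerProductGeometry.cos_angle_mul_norm_mul_norm x y]
  congr 1
  ring

theorem measurable_chord : Measurable fun t : ℝ × ℝ × ℝ => chord t.1 t.2.1 t.2.2 := by
  unfold chord
  fun_prop

theorem image_chord {r₁ r₂ : ℝ} (h₁ : 0 < r₁) (h₂ : 0 < r₂) :
    (fun θ => chord r₁ r₂ θ) '' Ioo 0 Real.pi = Ioo |r₁ - r₂| (r₁ + r₂) := by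
  have h12 : 0 < r₁ * r₂ := mul_pos h₁ h₂
  ext z
  constructor
  · rintro ⟨θ, hθ, rfl⟩
    have hm1 : -1 < Real.cos θ := by
      rw [← Real.cos_pi]
      exact Real.cos_lt_cos_of_nonneg_of_le_pi hθ.1.le le_rfl hθ.2
    have hp1 : Real.cos θ < 1 := by
      rw [← Real.cos_zero]
      exact Real.cos_lt_cos_of_nonneg_of_le_pi le_rfl hθ.2.le hθ.1
    constructor
    · refine Real.lt_sqrt_of_sq_lt ?_
      rw [sq_abs]
      nlinarith [mul_pos h12 (by linarith : 0 < Real.cos θ + 1)]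
    · refine (Real.sqrt_lt' (by positivity)).2 ?_
      nlinarith [mul_pos h12 (by linarith : 0 < 1 - Real.cos θ)]
  · rintro ⟨hz1, hz2⟩
    have hz0 : 0 < z := (abs_nonneg _).trans_lt hz1
    have hsq1 : (r₁ - r₂) ^ 2 < z ^ 2 := by
      rw [← sq_abs (r₁ - r₂)]
      exact pow_lt_pow_left₀ hz1 (abs_nonneg _) two_ne_zero
    have hsq2 : z ^ 2 < (r₁ + r₂) ^ 2 := pow_lt_pow_left₀ hz2 hz0.le two_ne_zero
    have hm1 : -1 < (z ^ 2 - r₁ ^ 2 - r₂ ^ 2) / (2 * (r₁ * r₂)) := by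
      rw [lt_div_iff₀ (by positivity)]
      nlinarith
    have hp1 : (z ^ 2 - r₁ ^ 2 - r₂ ^ 2) / (2 * (r₁ * r₂)) < 1 := by
      rw [div_lt_one (by positivity)]
      nlinarith
    refine ⟨Real.arccos ((z ^ 2 - r₁ ^ 2 - r₂ ^ 2) / (2 * (r₁ * r₂))),
      ⟨Real.arccos_pos.2 hp1, ?_⟩, ?_⟩
    · refine lt_of_le_of_ne (Real.arccos_le_pi _) fun h => ?_
      have := Real.arccos_eq_pi.1 h
      linarith
    · simp only [chord]
      rw [Real.cos_arccos hm1.le hp1.le]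
      rw [show r₁ ^ 2 + r₂ ^ 2 + 2 * r₁ * r₂ * ((z ^ 2 - r₁ ^ 2 - r₂ ^ 2) / (2 * (r₁ * r₂))) =
        z ^ 2 by field_simp; ring, Real.sqrt_sq hz0.le]

theorem lintegral_chord {r₁ r₂ : ℝ} (h₁ : 0 < r₁) (h₂ : 0 < r₂) (k : ℝ → ℝ≥0∞) :
    ∫⁻ θ in Ioo 0 Real.pi, ENNReal.ofReal (r₁ * r₂ * Real.sin θ / chord r₁ r₂ θ) *
      k (chord r₁ r₂ θ) = ∫⁻ z in Ioo |r₁ - r₂| (r₁ + r₂), k z := by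
  have hder : ∀ θ ∈ Ioo 0 Real.pi, HasDerivWithinAt (fun θ => chord r₁ r₂ θ)
      (-(r₁ * r₂ * Real.sin θ / chord r₁ r₂ θ)) (Ioo 0 Real.pi) θ := fun θ hθ => by
    have h := (((Real.hasDerivAt_cos θ).const_mul (2 * r₁ * r₂)).const_add
      (r₁ ^ 2 + r₂ ^ 2)).sqrt (chord_sq_pos h₁ h₂ hθ).ne'
    refine (h.congr_deriv ?_).hasDerivWithinAt
    rw [chord]
    have := (Real.sqrt_pos.2 (chord_sq_pos h₁ h₂ hθ)).ne'
    field_simp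
  have hinj : InjOn (fun θ => chord r₁ r₂ θ) (Ioo 0 Real.pi) := fun θ hθ η hη h => by
    have h' := (Real.sqrt_inj (chord_sq_pos h₁ h₂ hθ).le (chord_sq_pos h₁ h₂ hη).le).1 h
    refine Real.injOn_cos ⟨hθ.1.le, hθ.2.le⟩ ⟨hη.1.le, hη.2.le⟩ ?_
    have : 2 * r₁ * r₂ ≠ 0 := by positivity
    exact mul_left_cancel₀ this (add_left_cancel h')
  rw [← image_chord h₁ h₂, lintegral_image_eq_lintegral_abs_deriv_mul measurableSet_Ioo hder hinj]
  refine setLIntegral_congr_fun measurableSet_Ioo fun θ hθ => ?_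
  have h0 : 0 ≤ r₁ * r₂ * Real.sin θ / chord r₁ r₂ θ := by
    have := Real.sin_pos_of_mem_Ioo hθ
    have := chord_pos h₁ h₂ hθ
    positivity
  simp only [abs_neg, abs_of_nonneg h0]

theorem lintegral_half_add_half_sub {W : ℝ × ℝ → ℝ≥0∞} (hW : Measurable W) :
    ∫⁻ p : ℝ × ℝ, W ((p.1 + p.2) / 2, (p.1 - p.2) / 2) = 2 * ∫⁻ q : ℝ × ℝ, W q := by
  have h2 : ∫⁻ y : ℝ, ∫⁻ x : ℝ, W (x, y / 2) = 2 * ∫⁻ y : ℝ, ∫⁻ x : ℝ, W (x, y) := by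
    have himg : (fun y : ℝ => 2 * y) '' univ = univ :=
      image_univ_of_surjective (mul_left_surjective₀ two_ne_zero)
    have h := lintegral_image_eq_lintegral_abs_deriv_mul MeasurableSet.univ
      (f := fun y : ℝ => 2 * y) (f' := fun _ => 2)
      (fun y _ => by simpa using (hasDerivAt_id y).const_mul 2)
      (mul_right_injective₀ (two_ne_zero (α := ℝ))).injOn
      (fun y => ∫⁻ x : ℝ, W (x, y / 2))
    rw [himg, setLIntegral_univ, setLIntegral_univ] at h
    rw [h, ← lintegral_const_mul _ (by fun_prop)]
    refine lintegral_congr fun y => ?_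
    rw [mul_div_cancel_left₀ _ two_ne_zero]
    simp
  rw [Measure.volume_eq_prod, lintegral_prod_symm' _ (by fun_prop),
    lintegral_prod_symm' _ hW, ← h2]
  have h3 : ∀ b : ℝ, ∫⁻ a : ℝ, W ((a + b) / 2, (a - b) / 2) = ∫⁻ a : ℝ, W (b + a / 2, a / 2) := by
    intro b
    rw [← lintegral_add_right_eq_self _ b]
    refine lintegral_congr fun a => ?_
    congr 2 <;> ring
  simp only [h3]
  rw [lintegral_lintegral_swap (Measurable.aemeasurable (by fun_prop))]
  refine lintegral_congr fun a => ?_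
  exact lintegral_add_right_eq_self (fun b => W (b, a / 2)) (a / 2)

theorem measurableSet_regionXYZ :
    MeasurableSet {t : ℝ × ℝ × ℝ | 0 < t.2.2 ∧ t.2.2 / 2 < t.1 ∧ |t.2.1| < t.2.2 / 2} := by
  have h : {t : ℝ × ℝ × ℝ | 0 < t.2.2 ∧ t.2.2 / 2 < t.1 ∧ |t.2.1| < t.2.2 / 2} =
      {t | 0 < t.2.2} ∩ ({t | t.2.2 / 2 < t.1} ∩ {t | |t.2.1| < t.2.2 / 2}) := by
    ext t
    simp
  rw [h]
  exact (measurableSet_lt (by fun_prop) (by fun_prop)).inter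
    ((measurableSet_lt (by fun_prop) (by fun_prop)).inter
      (measurableSet_lt (by fun_prop) (by fun_prop)))

theorem lintegral_chord_half_sum {Q : ℝ × ℝ × ℝ → ℝ≥0∞} (hQ : Measurable Q) :
    ∫⁻ t in Ioi (0 : ℝ) ×ˢ Ioi (0 : ℝ) ×ˢ Ioo 0 Real.pi,
        ENNReal.ofReal (t.1 * t.2.1 * Real.sin t.2.2 / chord t.1 t.2.1 t.2.2) *
          Q ((t.1 + t.2.1) / 2, (t.1 - t.2.1) / 2, chord t.1 t.2.1 t.2.2) =
      2 * ∫⁻ t in {t : ℝ × ℝ × ℝ | 0 < t.2.2 ∧ t.2.2 / 2 < t.1 ∧ |t.2.1| < t.2.2 / 2}, Q t := by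
  have hc := measurable_chord
  set S : Set (ℝ × ℝ × ℝ) := {t | 0 < t.2.2 ∧ t.2.2 / 2 < t.1 ∧ |t.2.1| < t.2.2 / 2} with hSdef
  have hS : MeasurableSet S := measurableSet_regionXYZ
  let W : ℝ × ℝ → ℝ≥0∞ := fun q => ∫⁻ z : ℝ, S.indicator Q (q.1, q.2, z)
  have hQS := hQ.indicator hS
  have hW : Measurable W := by fun_prop
  have hR : ∫⁻ t in S, Q t = ∫⁻ q, W q := by
    rw [← lintegral_indicator hS, Measure.volume_eq_prod, lintegral_prod _ hQS.aemeasurable,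
      Measure.volume_eq_prod, lintegral_prod _ hW.aemeasurable]
    refine lintegral_congr fun x => ?_
    rw [lintegral_prod _ (by fun_prop)]
  rw [hR, ← lintegral_half_add_half_sub hW, Measure.volume_eq_prod, Measure.volume_eq_prod,
    ← Measure.prod_restrict, ← Measure.prod_restrict, lintegral_prod _ (by fun_prop),
    lintegral_prod _ (by fun_prop), ← lintegral_indicator measurableSet_Ioi]
  refine lintegral_congr fun r₁ => ?_
  have hzero : ∀ r₂ : ℝ, ¬ (0 < r₁ ∧ 0 < r₂) → W ((r₁ + r₂) / 2, (r₁ - r₂) / 2) = 0 := by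
    intro r₂ h
    refine (lintegral_congr fun z => ?_).trans lintegral_zero
    refine indicator_of_notMem (fun hz => h ?_) _
    obtain ⟨h1, h2, h3⟩ := hz
    simp only at h1 h2 h3
    have := abs_lt.1 h3
    constructor <;> linarith
  by_cases h₁ : 0 < r₁
  · rw [indicator_of_mem (show r₁ ∈ Ioi (0 : ℝ) from h₁), lintegral_prod _ (by fun_prop),
      ← lintegral_indicator measurableSet_Ioi]
    refine lintegral_congr fun r₂ => ?_
    by_cases h₂ : 0 < r₂
    · rw [indicator_of_mem (show r₂ ∈ Ioi (0 : ℝ) from h₂)]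
      refine (lintegral_chord h₁ h₂
        (fun z => Q ((r₁ + r₂) / 2, (r₁ - r₂) / 2, z))).trans ?_
      rw [← lintegral_indicator measurableSet_Ioo]
      refine lintegral_congr fun z => ?_
      have hiff : z ∈ Ioo |r₁ - r₂| (r₁ + r₂) ↔ ((r₁ + r₂) / 2, (r₁ - r₂) / 2, z) ∈ S := by
        simp only [hSdef, mem_Ioo, mem_ofPred_eq, abs_div, abs_two]
        constructor
        · rintro ⟨h, h'⟩
          exact ⟨(abs_nonneg _).trans_lt h, by linarith, by linarith⟩
        · rintro ⟨_, h, h'⟩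
          exact ⟨by linarith, by linarith⟩
      by_cases hz : z ∈ Ioo |r₁ - r₂| (r₁ + r₂)
      · rw [indicator_of_mem hz, indicator_of_mem (hiff.1 hz)]
      · rw [indicator_of_notMem hz, indicator_of_notMem fun h => hz (hiff.2 h)]
    · rw [indicator_of_notMem (show r₂ ∉ Ioi (0 : ℝ) from h₂), hzero r₂ fun h => h₂ h.2]
  · rw [indicator_of_notMem (show r₁ ∉ Ioi (0 : ℝ) from h₁)]
    exact ((lintegral_congr fun r₂ => hzero r₂ fun h => h₁ h.1).trans lintegral_zero).symm

theorem sumDensity_div_sumDensity_zero {M : ℕ} (hM : 2 ≤ M) {z : ℝ} (hz : 0 < z) :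
    sumDensity M z / sumDensity (M + 2) 0 =
      8 * (Real.Gamma ((M + 2 : ℕ) : ℝ) /
        (Real.sqrt Real.pi * Real.Gamma (2 * ((M + 2 : ℕ) : ℝ) - 4))) *
        z ^ (((M + 2 : ℕ) : ℝ) - 7 / 2) * besselK (((M + 2 : ℕ) : ℝ) - 7 / 2) (z / 2) := by
  have hM' : (2 : ℝ) ≤ M := by exact_mod_cast hM
  have hpi := Real.pi_pos
  rw [sumDensity_eq_besselK (by omega) hz, sumDensity_zero (by omega)]
  have e1 : ((M + 2 : ℕ) : ℝ) - 7 / 2 = M - 3 / 2 := by push_cast; ring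
  have e2 : 2 * ((M + 2 : ℕ) : ℝ) - 4 = 2 * M := by push_cast; ring
  have e3 : ((M + 2 : ℕ) : ℝ) - 3 / 2 = M + 1 / 2 := by push_cast; ring
  rw [e1, e2, e3]
  have hdup := Real.Gamma_mul_Gamma_add_half (M : ℝ)
  have g1 : 0 < Real.Gamma (M : ℝ) := Real.Gamma_pos_of_pos (by linarith)
  have g2 : 0 < Real.Gamma ((M : ℝ) + 1 / 2) := Real.Gamma_pos_of_pos (by linarith)
  have g3 : 0 < Real.Gamma (2 * (M : ℝ)) := Real.Gamma_pos_of_pos (by linarith)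
  have g4 : 0 < Real.Gamma ((M + 2 : ℕ) : ℝ) := Real.Gamma_pos_of_pos (by positivity)
  have hsp : 0 < Real.sqrt Real.pi := Real.sqrt_pos.2 hpi
  have hc : 0 < (16 * Real.pi) ^ (3 / 2 : ℝ) := by positivity
  have h4 : (4 : ℝ) ^ ((M : ℝ) - 3 / 2) * 2 ^ (1 - 2 * (M : ℝ)) = 1 / 4 := by
    rw [show (4 : ℝ) = 2 ^ (2 : ℝ) by norm_num, ← Real.rpow_mul (by norm_num),
      ← Real.rpow_add (by norm_num),
      show 2 * ((M : ℝ) - 3 / 2) + (1 - 2 * (M : ℝ)) = -2 by ring, Real.rpow_neg (by norm_num)]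
    norm_num
  have h4p : 0 < (4 : ℝ) ^ ((M : ℝ) - 3 / 2) := by positivity
  rw [Real.div_rpow hz.le (by norm_num)]
  generalize besselK ((M : ℝ) - 3 / 2) (z / 2) = K
  generalize (4 : ℝ) ^ ((M : ℝ) - 3 / 2) = a at h4 h4p ⊢
  have hG : Real.sqrt Real.pi * Real.Gamma (2 * (M : ℝ)) =
      4 * a * (Real.Gamma M * Real.Gamma ((M : ℝ) + 1 / 2)) := by
    rw [hdup]
    linear_combination (-4 * Real.Gamma (2 * (M : ℝ)) * Real.sqrt Real.pi) * h4
  rw [hG]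
  field_simp
  ring

theorem inner_rot (A : SO3) (v w : E3) : inner ℝ (rot A v) (rot A w) = inner ℝ v w := by
  have hA : A.1.transpose * A.1 = 1 := by
    have := (Matrix.mem_specialOrthogonalGroup_iff.1 A.2).1
    exact (Matrix.mem_orthogonalGroup_iff' (Fin 3) ℝ).1 this
  simp only [rot, EuclideanSpace.inner_eq_star_dotProduct, star_trivial]
  rw [Matrix.dotProduct_mulVec, ← Matrix.mulVec_transpose, Matrix.mulVec_mulVec, hA,
    Matrix.one_mulVec]

theorem norm_rot (A : SO3) (v : E3) : ‖rot A v‖ = ‖v‖ := by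
  rw [norm_eq_sqrt_real_inner, inner_rot, ← norm_eq_sqrt_real_inner]

theorem angle_rot (A : SO3) (v w : E3) :
    InnerProductGeometry.angle (rot A v) (rot A w) = InnerProductGeometry.angle v w := by
  simp only [InnerProductGeometry.angle, inner_rot, norm_rot]

/-- A rotation as a linear isometry of `ℝ³`. -/
def rotLinearIsometry (A : SO3) : E3 →ₗᵢ[ℝ] E3 where
  toFun := rot A
  map_add' v w := by simp [rot, Matrix.mulVec_add]
  map_smul' c v := by simp [rot, Matrix.mulVec_smul]
  norm_map' := norm_rot A

theorem measurePreserving_rot (A : SO3) : MeasurePreserving (rot A) :=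
  ((rotLinearIsometry A).toLinearIsometryEquiv rfl).measurePreserving

theorem map_withDensity_eq_self {X : Type*} [MeasurableSpace X] {ν : Measure X} {T : X → X}
    (hT : MeasurePreserving T ν ν) {D : X → ℝ≥0∞} (hD : Measurable D) (hDT : ∀ x, D (T x) = D x) :
    (ν.withDensity D).map T = ν.withDensity D := by
  ext s hs
  rw [Measure.map_apply hT.measurable hs, withDensity_apply _ (hT.measurable hs),
    withDensity_apply _ hs, ← hT.setLIntegral_comp_preimage hs hD]
  simp only [hDT]

theorem map_withDensity_comp {X Y : Type*} [MeasurableSpace X] [MeasurableSpace Y] {ν : Measure X}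
    {ρ : Measure Y} {Φ : X → Y} (hΦ : Measurable Φ) {F w : Y → ℝ≥0∞} (hF : Measurable F)
    (h : ∀ H : Y → ℝ≥0∞, Measurable H → ∫⁻ x, H (Φ x) ∂ν = ∫⁻ y, w y * H y ∂ρ) :
    (ν.withDensity fun x => F (Φ x)).map Φ = ρ.withDensity fun y => w y * F y := by
  ext s hs
  rw [Measure.map_apply hΦ hs, withDensity_apply _ (hΦ hs), withDensity_apply _ hs,
    ← lintegral_indicator (hΦ hs), ← lintegral_indicator hs]
  refine (h (s.indicator F) (hF.indicator hs)).trans (lintegral_congr fun y => ?_)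
  by_cases hy : y ∈ s
  · simp [hy]
  · simp [hy]

/-- The density of a pair of edges of a closed `n`-gon, `n = M + 2`, as a function of the two
lengths and the angle. -/
def pairVolumeDensity (M : ℕ) (t : ℝ × ℝ × ℝ) : ℝ :=
  edgeDensity t.1 * edgeDensity t.2.1 *
    (sumDensity M (chord t.1 t.2.1 t.2.2) / sumDensity (M + 2) 0)

theorem measurable_pairVolumeDensity (M : ℕ) : Measurable (pairVolumeDensity M) := by
  have := (measurable_sumDensity M).comp measurable_chord
  simp only [Function.comp_def] at this
  unfold pairVolumeDensity
  fun_prop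

theorem measurable_lengths_angle : Measurable fun p : E3 × E3 =>
    (‖p.1‖, ‖p.2‖, InnerProductGeometry.angle p.1 p.2) := by
  fun_prop

theorem edgePairLaw_eq {M : ℕ} (hM : 2 ≤ M) {μ : Measure (closedPolygons (M + 2))}
    (hμ : IsHopfGaussianPolygonMeasure (M + 2) μ) (i : Fin (M + 2)) :
    edgePairLaw μ i = (volume : Measure (E3 × E3)).withDensity fun p =>
      ENNReal.ofReal (pairVolumeDensity M (‖p.1‖, ‖p.2‖, InnerProductGeometry.angle p.1 p.2)) := by
  have hij : i ≠ finRotate (M + 2) i := by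
    rw [finRotate_apply]
    simp
  rw [edgePairLaw, hμ.map_pair hM hij]
  simp only [norm_add_eq_chord, pairVolumeDensity]

theorem pairDensity_eq {M : ℕ} (hM : 2 ≤ M) {r₁ r₂ θ : ℝ} (h₁ : 0 < r₁) (h₂ : 0 < r₂)
    (hθ : θ ∈ Ioo 0 Real.pi) :
    8 * Real.pi ^ 2 * (r₁ ^ 2 * r₂ ^ 2 * Real.sin θ) * pairVolumeDensity M (r₁, r₂, θ) =
      pairDensity (M + 2) r₁ r₂ θ := by
  have hpi := Real.pi_pos
  have hsp : 0 < Real.sqrt Real.pi := Real.sqrt_pos.2 hpi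
  have hG : 0 < Real.Gamma (2 * ((M + 2 : ℕ) : ℝ) - 4) :=
    Real.Gamma_pos_of_pos (by push_cast; have : (2 : ℝ) ≤ M := by exact_mod_cast hM
                              linarith)
  simp only [pairVolumeDensity, pairDensity]
  rw [sumDensity_div_sumDensity_zero hM (chord_pos h₁ h₂ hθ), edgeDensity, edgeDensity,
    show -(1 / 2) * (r₁ + r₂) = -(r₁ / 2) + -(r₂ / 2) by ring, Real.exp_add]
  field_simp
  ring

theorem pairDensity_eq_mul_pairDensityXYZ (n : ℕ) {r₁ r₂ θ : ℝ} (h₁ : 0 < r₁) (h₂ : 0 < r₂)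
    (hθ : θ ∈ Ioo 0 Real.pi) :
    pairDensity n r₁ r₂ θ = r₁ * r₂ * Real.sin θ / chord r₁ r₂ θ *
      (2⁻¹ * pairDensityXYZ n ((r₁ + r₂) / 2) ((r₁ - r₂) / 2) (chord r₁ r₂ θ)) := by
  have hz := chord_pos h₁ h₂ hθ
  simp only [pairDensity, pairDensityXYZ]
  rw [show (n : ℝ) - 5 / 2 = (n - 7 / 2) + 1 by ring, Real.rpow_add_one hz.ne',
    show -(1 / 2) * (r₁ + r₂) = -((r₁ + r₂) / 2) by ring]
  generalize besselK ((n : ℝ) - 7 / 2) (chord r₁ r₂ θ / 2) = K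
  field_simp
  norm_num

/-- The density of `(x, y, z)`, written with the density of the sum of the remaining edges. -/
def mixtureDensityXYZ (M : ℕ) (t : ℝ × ℝ × ℝ) : ℝ :=
  Real.exp (-t.1) * t.2.2 * (sumDensity M t.2.2 / sumDensity (M + 2) 0) / 16

theorem pairDensityXYZ_eq {M : ℕ} (hM : 2 ≤ M) {x y z : ℝ} (hz : 0 < z) :
    pairDensityXYZ (M + 2) x y z = mixtureDensityXYZ M (x, y, z) := by
  simp only [pairDensityXYZ, mixtureDensityXYZ]
  rw [sumDensity_div_sumDensity_zero hM hz,
    show ((M + 2 : ℕ) : ℝ) - 5 / 2 = (((M + 2 : ℕ) : ℝ) - 7 / 2) + 1 by ring,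
    Real.rpow_add_one hz.ne']
  field_simp
  ring

theorem map_lengths_angle {M : ℕ} (hM : 2 ≤ M) {μ : Measure (closedPolygons (M + 2))}
    (hμ : IsHopfGaussianPolygonMeasure (M + 2) μ) (i : Fin (M + 2)) :
    (edgePairLaw μ i).map (fun p => (‖p.1‖, ‖p.2‖, InnerProductGeometry.angle p.1 p.2)) =
      ((volume : Measure (ℝ × ℝ × ℝ)).restrict (Ioi 0 ×ˢ Ioi 0 ×ˢ Ioo 0 Real.pi)).withDensity
        (fun t => ENNReal.ofReal (pairDensity (M + 2) t.1 t.2.1 t.2.2)) := by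
  have hF := (measurable_pairVolumeDensity M).ennreal_ofReal
  rw [edgePairLaw_eq hM hμ, map_withDensity_comp measurable_lengths_angle hF
    fun H hH => lintegral_norm_norm_angle hH]
  refine withDensity_congr_ae ?_
  filter_upwards [ae_restrict_mem
    (measurableSet_Ioi.prod (measurableSet_Ioi.prod measurableSet_Ioo))] with t ht
  obtain ⟨h₁, h₂, hθ⟩ := ht
  have h₁ : 0 < t.1 := h₁
  have h₂ : 0 < t.2.1 := h₂
  have hs := Real.sin_pos_of_mem_Ioo hθ
  rw [← ENNReal.ofReal_mul (by positivity), pairDensity_eq hM h₁ h₂ hθ]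

theorem map_half_sum_half_diff_chord {M : ℕ} (hM : 2 ≤ M) :
    (((volume : Measure (ℝ × ℝ × ℝ)).restrict (Ioi 0 ×ˢ Ioi 0 ×ˢ Ioo 0 Real.pi)).withDensity
        (fun t => ENNReal.ofReal (pairDensity (M + 2) t.1 t.2.1 t.2.2))).map
      (fun t => ((t.1 + t.2.1) / 2, (t.1 - t.2.1) / 2, chord t.1 t.2.1 t.2.2)) =
    ((volume : Measure (ℝ × ℝ × ℝ)).restrict
      {t | 0 < t.2.2 ∧ t.2.2 / 2 < t.1 ∧ |t.2.1| < t.2.2 / 2}).withDensity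
      (fun t => ENNReal.ofReal (pairDensityXYZ (M + 2) t.1 t.2.1 t.2.2)) := by
  have hΨ : Measurable fun t : ℝ × ℝ × ℝ =>
      ((t.1 + t.2.1) / 2, (t.1 - t.2.1) / 2, chord t.1 t.2.1 t.2.2) := by
    have := measurable_chord
    fun_prop
  let Q : ℝ × ℝ × ℝ → ℝ≥0∞ := fun t => 2⁻¹ * ENNReal.ofReal (mixtureDensityXYZ M t)
  have hQ : Measurable Q := by
    unfold Q mixtureDensityXYZ
    fun_prop
  have hl : ∀ t ∈ Ioi (0 : ℝ) ×ˢ Ioi (0 : ℝ) ×ˢ Ioo 0 Real.pi,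
      ENNReal.ofReal (pairDensity (M + 2) t.1 t.2.1 t.2.2) =
        ENNReal.ofReal (t.1 * t.2.1 * Real.sin t.2.2 / chord t.1 t.2.1 t.2.2) *
          Q ((t.1 + t.2.1) / 2, (t.1 - t.2.1) / 2, chord t.1 t.2.1 t.2.2) := by
    rintro t ⟨h₁, h₂, hθ⟩
    have h₁ : 0 < t.1 := h₁
    have h₂ : 0 < t.2.1 := h₂
    have hs := Real.sin_pos_of_mem_Ioo hθ
    have hz := chord_pos h₁ h₂ hθ
    rw [pairDensity_eq_mul_pairDensityXYZ _ h₁ h₂ hθ, ENNReal.ofReal_mul (by positivity),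
      ENNReal.ofReal_mul (by norm_num), ENNReal.ofReal_inv_of_pos (by norm_num),
      pairDensityXYZ_eq hM hz]
    simp [Q]
  have hR := measurableSet_Ioi (a := (0 : ℝ)) |>.prod
    ((measurableSet_Ioi (a := (0 : ℝ))).prod (measurableSet_Ioo (a := (0 : ℝ)) (b := Real.pi)))
  ext s hs
  rw [Measure.map_apply hΨ hs, withDensity_apply _ (hΨ hs), withDensity_apply _ hs,
    ← lintegral_indicator (hΨ hs), ← lintegral_indicator hs]
  have h1 := lintegral_chord_half_sum (hQ.indicator hs)
  rw [← lintegral_const_mul _ (hQ.indicator hs)] at h1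
  refine Eq.trans (setLIntegral_congr_fun hR fun t ht => ?_) (h1.trans
    (setLIntegral_congr_fun measurableSet_regionXYZ fun t ht => ?_))
  · by_cases hts : ((t.1 + t.2.1) / 2, (t.1 - t.2.1) / 2, chord t.1 t.2.1 t.2.2) ∈ s
    · simp only [Set.indicator, mem_preimage, hts, if_true, hl t ht]
    · simp only [Set.indicator, mem_preimage, hts, if_false, mul_zero]
  · by_cases hts : t ∈ s
    · rw [indicator_of_mem hts, indicator_of_mem hts, pairDensityXYZ_eq hM ht.1, ← mul_assoc,
        ENNReal.mul_inv_cancel two_ne_zero ENNReal.ofNat_ne_top, one_mul]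
    · rw [indicator_of_notMem hts, indicator_of_notMem hts, mul_zero]

end HopfPolygon

end

open HopfPolygon in
theorem proposition9 (n : ℕ) (hn : 3 < n) :
    -- the Hopf-Gaussian measure on closed polygons exists and is unique
    (∃! μ : Measure (closedPolygons n), IsHopfGaussianPolygonMeasure n μ) ∧
    ∀ μ : Measure (closedPolygons n), IsHopfGaussianPolygonMeasure n μ → ∀ i : Fin n,
      -- invariance under the diagonal action of the rotation group
      (∀ A : SO3, (edgePairLaw μ i).map (fun p => (rot A p.1, rot A p.2)) = edgePairLaw μ i) ∧
      -- invariance under rotations that fix the first edge, or the second edge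
      (∀ R : E3 → SO3, (∀ v, rot (R v) v = v) → Measurable (fun p : E3 × E3 => rot (R p.1) p.2) →
        (edgePairLaw μ i).map (fun p => (p.1, rot (R p.1) p.2)) = edgePairLaw μ i ∧
        (edgePairLaw μ i).map (fun p => (rot (R p.2) p.1, p.2)) = edgePairLaw μ i) ∧
      -- the joint density depends only on the two lengths and the angle
      (∃ F : ℝ × ℝ × ℝ → ℝ≥0∞, Measurable F ∧
        edgePairLaw μ i = (volume : Measure (E3 × E3)).withDensity
          (fun p => F (‖p.1‖, ‖p.2‖, InnerProductGeometry.angle p.1 p.2))) ∧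
      -- the density in the variables `r₁, r₂, θ`
      (edgePairLaw μ i).map
          (fun p => (‖p.1‖, ‖p.2‖, InnerProductGeometry.angle p.1 p.2)) =
        ((volume : Measure (ℝ × ℝ × ℝ)).restrict
          (Set.Ioi 0 ×ˢ Set.Ioi 0 ×ˢ Set.Ioo 0 Real.pi)).withDensity
          (fun t => ENNReal.ofReal (pairDensity n t.1 t.2.1 t.2.2)) ∧
      -- the density in the variables `x = (r₁ + r₂) / 2`, `y = (r₁ - r₂) / 2`, `z = ‖e₁ + e₂‖`
      (edgePairLaw μ i).map
          (fun p => ((‖p.1‖ + ‖p.2‖) / 2, (‖p.1‖ - ‖p.2‖) / 2, ‖p.1 + p.2‖)) =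
        ((volume : Measure (ℝ × ℝ × ℝ)).restrict
          {t | 0 < t.2.2 ∧ t.2.2 / 2 < t.1 ∧ |t.2.1| < t.2.2 / 2}).withDensity
          (fun t => ENNReal.ofReal (pairDensityXYZ n t.1 t.2.1 t.2.2)) := by
  obtain ⟨M, rfl⟩ : ∃ M, n = M + 2 := ⟨n - 2, by omega⟩
  have hM : 2 ≤ M := by omega
  refine ⟨⟨polygonMeasure (M + 1), isHopfGaussianPolygonMeasure_polygonMeasure (by omega),
    fun ν hν => hν.unique (isHopfGaussianPolygonMeasure_polygonMeasure (by omega))⟩,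
    fun μ hμ i => ?_⟩
  have hF := (measurable_pairVolumeDensity M).ennreal_ofReal
  have hD := hF.comp measurable_lengths_angle
  refine ⟨fun A => ?_, fun R hR hRm => ?_, ⟨_, hF, edgePairLaw_eq hM hμ i⟩,
    map_lengths_angle hM hμ i, ?_⟩
  · rw [edgePairLaw_eq hM hμ i]
    refine map_withDensity_eq_self
      ((measurePreserving_rot A).prod (measurePreserving_rot A)) hD fun p => ?_
    simp only [Prod.map, norm_rot, angle_rot]
  · have hT : MeasurePreserving (fun p : E3 × E3 => (p.1, rot (R p.1) p.2)) :=
      (MeasurePreserving.id (volume : Measure E3)).skew_product (g := fun v w => rot (R v) w) hRm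
        (Eventually.of_forall fun v => (measurePreserving_rot (R v)).map_eq)
    have hT' : MeasurePreserving (fun p : E3 × E3 => (rot (R p.2) p.1, p.2)) :=
      (Measure.measurePreserving_swap (μ := (volume : Measure E3)) (ν := (volume : Measure E3))).comp
        (hT.comp Measure.measurePreserving_swap)
    have hang : ∀ v w, InnerProductGeometry.angle v (rot (R v) w) =
        InnerProductGeometry.angle v w := fun v w => by
      have h := angle_rot (R v) v w
      rwa [hR v] at h
    rw [edgePairLaw_eq hM hμ i]
    refine ⟨map_withDensity_eq_self hT hD fun p => ?_, map_withDensity_eq_self hT' hD fun p => ?_⟩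
    · simp only [norm_rot, hang]
    · simp only [norm_rot]
      rw [InnerProductGeometry.angle_comm, hang, InnerProductGeometry.angle_comm]
  · rw [← map_half_sum_half_diff_chord hM, ← map_lengths_angle hM hμ i, Measure.map_map
      (by have := measurable_chord; fun_prop) measurable_lengths_angle]
    simp only [Function.comp_def, norm_add_eq_chord]
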